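/- **Theorem 5.1 (Asymptotic subordination property).** Let $N,k\ge 1$ and $p,q\ge 0$ be integers. Let $\mathbf X_N=(X_1,\dots,X_p)$ be independent normalized $N\times N$ GUE matrices: each $X_j$ is a random Hermitian matrix, and the $N^2$ real random variables $(X_j)_{nn}$ ($1\le n\le N$), $\sqrt2\,\mathrm{Re}\,(X_j)_{nm}$, $\sqrt2\,\mathrm{Im}\,(X_j)_{nm}$ ($1\le n<m\le N$) form a centered Gaussian vector with covariance matrix $\frac1N\mathbf 1_{N^2}$. Let $\mathbf Y_N=(Y_1,\dots,Y_q)$ be a family of random Hermitian $N\times N$ matrices, independent of $\mathbf X_N$. Let $a_1,\dots,a_p,b_1,\dots,b_q\in \mathrm M_k(\mathbb C)$ be Hermitian and set $$S_N=\sum_{j=1}^p a_j\otimes X_j,\qquad T_N=\sum_{j=1}^q b_j\otimes Y_j .$$ Assume that for some $\sigma\ge 1$ the joint law of the entries of $\mathbf Y_N$ satisfies a Poincaré inequality with constant $\sigma/N$: for every $f:\mathbb R^{2qN^2}\to\mathbb C$ of class $\mathcal C^1$, viewed as a function of the real and imaginary parts of all the entries of $q$ matrices, with $\mathbb E[|f(\mathbf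 Y_N)|^2]<\infty$, one has $$\mathbb E\big[|f(\mathbf Y_N)-\mathbb E[f(\mathbf Y_N)]|^2\big]\le \frac{\sigma}{N}\,\mathbb E\big[\|\nabla f(\mathbf Y_N)\|^2\big],\qquad \|\nabla f\|^2=\sum_i|\partial_i f|^2,$$ where the right-hand side may be $+\infty$. Write $\mathrm{Im}\,\Lambda=(\Lambda-\Lambda^*)/(2i)$, $\mathrm M_k(\mathbb C)^+=\{\Lambda\in\mathrm M_k(\mathbb C): \mathrm{Im}\,\Lambda>0\}$ (positive definite), $\tau_N=\frac1N\mathrm{Tr}$ for the normalized trace on $\mathrm M_N(\mathbb C)$, $\mathcal R_s(M)=\sum_{j=1}^p a_jMa_j$ for $M\in\mathrm M_k(\mathbb C)$, and $\|\cdot\|$ for the operator norm on $\mathrm M_k(\mathbb C)$. For $Z\in\{S_N+T_N,\,T_N\}$ and $\Lambda\in\mathrm M_k(\mathbb C)^+$ put $$G_Z(\Lambda)=\mathbb E\Big[(\mathrm{id}_k\otimes\tau_N)\big[(\Lambda\otimes\mathbf 1_N-Z)^{-1}\big]\Big].$$ Then these expressions are well defined ($\Lambda\otimes \mathbf 1_N-Z$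 is almost surely invertible and the random matrix inside the expectation is integrable), and there is an analytic map $\Theta_N:\mathrm M_k(\mathbb C)^+\to\mathrm M_k(\mathbb C)$ such that for every $\Lambda\in\mathrm M_k(\mathbb C)^+$ one has $\Lambda-\mathcal R_s(G_{S_N+T_N}(\Lambda))\in\mathrm M_k(\mathbb C)^+$, $$G_{S_N+T_N}(\Lambda)=G_{T_N}\Big(\Lambda-\mathcal R_s\big(G_{S_N+T_N}(\Lambda)\big)\Big)+\Theta_N(\Lambda)$$ and $$\|\Theta_N(\Lambda)\|\le\frac{c}{N^2}\,\big\|(\mathrm{Im}\,\Lambda)^{-1}\big\|^5,\qquad c=2k^{9/2}\sigma\Big(\sum_{j=1}^p\|a_j\|^2\Big)\Big(\sum_{j=1}^p\|a_j\|+\sum_{j=1}^q\|b_j\|\Big)^2 .$$ -/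

import Mathlib

open MeasureTheory ProbabilityTheory Matrix
open scoped Kronecker ComplexOrder Matrix.Norms.L2Operator

noncomputable section

namespace AsymptoticSubordination

/-- Complex matrices carry the product (entrywise Borel) σ-algebra. -/
instance instMeasurableSpaceMatrix {m n : Type*} : MeasurableSpace (Matrix m n ℂ) :=
  inferInstanceAs (MeasurableSpace (m → n → ℂ))

/-- The Hermitian imaginary part `Im Λ = (Λ - Λ*) / (2i)` of a square complex matrix. -/
def imPart {k : ℕ} (Λ : Matrix (Fin k) (Fin k) ℂ) : Matrix (Fin k) (Fin k) ℂ :=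
  (2 * Complex.I)⁻¹ • (Λ - Λᴴ)

/-- The upper half-space `M_k(ℂ)⁺` of matrices whose imaginary part is positive definite. -/
def upperHalf (k : ℕ) : Set (Matrix (Fin k) (Fin k) ℂ) :=
  {Λ | (imPart Λ).PosDef}

/-- The `N²` real coordinates of an `N × N` Hermitian matrix: the diagonal entries `M n n`, and,
for `n < m`, `√2 Re (M n m)` (stored at `(n, m)`) and `√2 Im (M n m)` (stored at `(m, n)`). -/
def hermitianCoords {N : ℕ} (M : Matrix (Fin N) (Fin N) ℂ) : Fin N × Fin N → ℝ := fun i =>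
  if i.1 = i.2 then (M i.1 i.1).re
  else if i.1 < i.2 then √2 * (M i.1 i.2).re
  else √2 * (M i.2 i.1).im

/-- `X` is a normalized `N × N` GUE matrix: it is a random Hermitian matrix, and its `N²` real
coordinates form a centered Gaussian vector with covariance matrix `N⁻¹ • 1`, that is, their joint
law is the product of `N²` copies of the centered normal law with variance `1 / N`. -/
structure IsGUE {Ω : Type*} [MeasurableSpace Ω] (P : Measure Ω) {N : ℕ}
    (X : Ω → Matrix (Fin N) (Fin N) ℂ) : Prop where
  measurable : Measurable X
  isHermitian : ∀ᵐ ω ∂P, (X ω).IsHermitian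
  hasLaw : HasLaw (fun ω => hermitianCoords (X ω))
    (Measure.pi fun _ : Fin N × Fin N => gaussianReal 0 (N : NNReal)⁻¹) P

/-- The real and imaginary parts of all the entries of `q` complex `N × N` matrices, as a vector
in `ℝ^{2qN²}`. -/
def realEntries {q N : ℕ} (Y : Fin q → Matrix (Fin N) (Fin N) ℂ) :
    (Fin q × Fin N × Fin N) ⊕ (Fin q × Fin N × Fin N) → ℝ :=
  Sum.elim (fun i => (Y i.1 i.2.1 i.2.2).re) (fun i => (Y i.1 i.2.1 i.2.2).im)

/-- The squared Euclidean norm `∑ᵢ |∂ᵢ f (x)|²` of the gradient of a complex-valued function of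
finitely many real variables. -/
def gradNormSq {ι : Type*} [Fintype ι] [DecidableEq ι] (f : (ι → ℝ) → ℂ) (x : ι → ℝ) : ℝ :=
  ∑ i, ‖fderiv ℝ f x (Pi.single i 1)‖ ^ 2

/-- The law `ν` on `ℝ^ι` satisfies a Poincaré inequality with constant `C`: for every `f` of class
`C¹` with `∫ |f|² dν < ∞`, one has `Var(f) ≤ C ∫ ‖∇f‖² dν`. Both sides are in `[0, ∞]`, so
that the inequality is void when `‖∇f‖²` is not integrable. -/
def PoincareInequality {ι : Type*} [Fintype ι] [DecidableEq ι] (ν : Measure (ι → ℝ)) (C : ℝ) :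
    Prop :=
  ∀ f : (ι → ℝ) → ℂ, ContDiff ℝ 1 f → MemLp f 2 ν →
    ∫⁻ x, ENNReal.ofReal (‖f x - ∫ y, f y ∂ν‖ ^ 2) ∂ν
      ≤ ENNReal.ofReal C * ∫⁻ x, ENNReal.ofReal (gradNormSq f x) ∂ν

/-- The partial trace `id_k ⊗ τ_N`, where `τ_N` is the normalized trace on `M_N(ℂ)`. -/
def partialTrace {k N : ℕ} (M : Matrix (Fin k × Fin N) (Fin k × Fin N) ℂ) :
    Matrix (Fin k) (Fin k) ℂ :=
  Matrix.of fun u v => (N : ℂ)⁻¹ * ∑ n, M (u, n) (v, n)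

/-- The block matrix `∑ⱼ aⱼ ⊗ Xⱼ`. -/
def blockSum {k N p : ℕ} (a : Fin p → Matrix (Fin k) (Fin k) ℂ)
    (X : Fin p → Matrix (Fin N) (Fin N) ℂ) : Matrix (Fin k × Fin N) (Fin k × Fin N) ℂ :=
  ∑ j, a j ⊗ₖ X j

/-- The matrix `Λ ⊗ 1_N - Z`. -/
def shifted {k N : ℕ} (Λ : Matrix (Fin k) (Fin k) ℂ)
    (Z : Matrix (Fin k × Fin N) (Fin k × Fin N) ℂ) : Matrix (Fin k × Fin N) (Fin k × Fin N) ℂ :=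
  Λ ⊗ₖ (1 : Matrix (Fin N) (Fin N) ℂ) - Z

/-- The `M_k(ℂ)`-valued Stieltjes transform
`G_Z(Λ) = 𝔼[(id_k ⊗ τ_N)[(Λ ⊗ 1_N - Z)⁻¹]]` of a random block matrix `Z`. -/
def stieltjes {Ω : Type*} [MeasurableSpace Ω] (P : Measure Ω) {k N : ℕ}
    (Z : Ω → Matrix (Fin k × Fin N) (Fin k × Fin N) ℂ) (Λ : Matrix (Fin k) (Fin k) ℂ) :
    Matrix (Fin k) (Fin k) ℂ :=
  ∫ ω, partialTrace (shifted Λ (Z ω))⁻¹ ∂P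

/-- The expression defining `G_Z(Λ)` is meaningful: `Λ ⊗ 1_N - Z` is almost surely invertible, and
the partial trace of its inverse is integrable. -/
def StieltjesDefined {Ω : Type*} [MeasurableSpace Ω] (P : Measure Ω) {k N : ℕ}
    (Z : Ω → Matrix (Fin k × Fin N) (Fin k × Fin N) ℂ) (Λ : Matrix (Fin k) (Fin k) ℂ) : Prop :=
  (∀ᵐ ω ∂P, IsUnit (shifted Λ (Z ω))) ∧
    Integrable (fun ω => partialTrace (shifted Λ (Z ω))⁻¹) P

/-- The map `𝓡ₛ : M ↦ ∑ⱼ aⱼ M aⱼ`. -/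
def covMap {k p : ℕ} (a : Fin p → Matrix (Fin k) (Fin k) ℂ) (M : Matrix (Fin k) (Fin k) ℂ) :
    Matrix (Fin k) (Fin k) ℂ :=
  ∑ j, a j * M * a j

end AsymptoticSubordination

end

open AsymptoticSubordination

/-! Everything is pulled back to a product of a Gaussian space and the law of the entries of `Y`.
There `S + T` becomes a real-linear, Hermitian-valued family `W(x, y) = ∑ xᵢ Dᵢ + ∑ yⱼ Fⱼ`, with `x`
Gaussian of covariance `1/N`. Let `R` be the resolvent of `W` at `Λ`, let `G` be the mean of its
partial trace, put `Γ = Λ - 𝓡ₛ(G)`, and let `Q` be the resolvent of `T` at `Γ`.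

Positivity: the resolvent at a point of the upper half-space has nonpositive imaginary part. The
partial trace, the expectation and `𝓡ₛ` preserve this sign, so `Im Γ ≥ Im Λ`. Hence both `R` and `Q`
are bounded by `‖(Im Λ)⁻¹‖`.

Exact identity: the resolvent equation gives `R - Q = Q (S - 𝓡ₛ(G) ⊗ 1) R`. Since `Q` does not
depend on the Gaussian variables, integration by parts differentiates only `R`, and the completeness
relation of an orthonormal basis of Hermitian matrices turns `E[Q S R]` into `E[Q (𝓡ₛ(tr R) ⊗ 1)
R]`, where `tr` is the partial trace (`integral_resolvent_mul_gaussian_mul_resolvent`). Thus the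
error `Θ` is the partial trace of `E[Q (𝓡ₛ(tr R - G) ⊗ 1) R]` (`meanResolvent_sub_eq`).

Estimate: expanded over the entries of the centered matrix `tr R - G`, each entry of `Θ` is a sum of
`k²` covariances. Cauchy–Schwarz reduces these to variances, and a Poincaré inequality for the
product law bounds each variance by `O(N⁻²)`: one factor `1/N` is the Poincaré constant, the other
comes from the gradient of a normalized trace (`IsHermitianFrame.sum_norm_sq_partialTrace_le`). The
Gaussian factor satisfies Poincaré with the non-optimal constant `π²/8`, by a rotation argument; the
slack in the final constant absorbs it.

Analyticity: near `Λ₀` the resolvent is `(1 + R₀ ((Λ - Λ₀) ⊗ 1))⁻¹ R₀` in the Banach algebra of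
bounded continuous matrix-valued functions. Inversion is analytic there, and integration is
continuous and linear. -/

noncomputable section

namespace AsymptoticSubordination

/-! ### Frobenius norm against operator norm -/

section Frobenius

variable {l m n : Type*} [Fintype l] [Fintype m] [Fintype n]

/-- The squared Frobenius norm of a complex matrix. -/
def frobSq (A : Matrix m n ℂ) : ℝ := ∑ i, ∑ j, ‖A i j‖ ^ 2

lemma frobSq_conjTranspose (A : Matrix m n ℂ) : frobSq Aᴴ = frobSq A := by
  simp only [frobSq, conjTranspose_apply, norm_star]
  exact Finset.sum_comm

lemma sum_norm_sq_mulVec_le [DecidableEq m] (A : Matrix l m ℂ) (x : m → ℂ) :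
    ∑ i, ‖(A *ᵥ x) i‖ ^ 2 ≤ ‖A‖ ^ 2 * ∑ i, ‖x i‖ ^ 2 := by
  have h := l2_opNorm_mulVec A (WithLp.toLp 2 x)
  have h2 := pow_le_pow_left₀ (norm_nonneg _) h 2
  rw [mul_pow, EuclideanSpace.norm_sq_eq, EuclideanSpace.norm_sq_eq] at h2
  simpa using h2

lemma frobSq_mul_le_left [DecidableEq m] (A : Matrix l m ℂ) (B : Matrix m n ℂ) :
    frobSq (A * B) ≤ ‖A‖ ^ 2 * frobSq B := by
  unfold frobSq
  rw [Finset.sum_comm, Finset.sum_comm (γ := m), Finset.mul_sum]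
  refine Finset.sum_le_sum fun j _ => ?_
  exact sum_norm_sq_mulVec_le A (fun i => B i j)

lemma frobSq_mul_le_right [DecidableEq m] [DecidableEq n] (A : Matrix l m ℂ) (B : Matrix m n ℂ) :
    frobSq (A * B) ≤ frobSq A * ‖B‖ ^ 2 := by
  rw [← frobSq_conjTranspose, conjTranspose_mul, mul_comm, ← frobSq_conjTranspose A,
    ← l2_opNorm_conjTranspose B]
  exact frobSq_mul_le_left _ _

lemma norm_sq_le_frobSq [DecidableEq n] (A : Matrix m n ℂ) : ‖A‖ ^ 2 ≤ frobSq A := by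
  have hA : 0 ≤ frobSq A := by unfold frobSq; positivity
  rw [← Real.le_sqrt (norm_nonneg _) hA, l2_opNorm_def]
  refine ContinuousLinearMap.opNorm_le_bound _ (Real.sqrt_nonneg _) fun x => ?_
  rw [← Real.sqrt_sq (norm_nonneg x), ← Real.sqrt_mul hA]
  refine Real.le_sqrt_of_sq_le ?_
  rw [EuclideanSpace.norm_sq_eq, EuclideanSpace.norm_sq_eq, frobSq, Finset.sum_mul]
  refine Finset.sum_le_sum fun i _ => ?_
  have : ‖∑ j, A i j * x j‖ ^ 2 ≤ (∑ j, ‖A i j‖ ^ 2) * ∑ j, ‖x j‖ ^ 2 := by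
    refine (pow_le_pow_left₀ (norm_nonneg _) (norm_sum_le _ _) 2).trans ?_
    simp only [norm_mul]
    exact Finset.sum_mul_sq_le_sq_mul_sq _ _ _
  exact this

lemma norm_le_of_entry_le {k : ℕ} (A : Matrix (Fin k) (Fin k) ℂ) {c : ℝ} (hc : 0 ≤ c)
    (h : ∀ i j, ‖A i j‖ ≤ c) : ‖A‖ ≤ k * c := by
  have h1 : frobSq A ≤ (k * c) ^ 2 := by
    calc frobSq A ≤ ∑ _i : Fin k, ∑ _j : Fin k, c ^ 2 :=
          Finset.sum_le_sum fun i _ => Finset.sum_le_sum fun j _ =>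
            pow_le_pow_left₀ (norm_nonneg _) (h i j) 2
      _ = (k * c) ^ 2 := by simp; ring
  exact le_of_sq_le_sq ((norm_sq_le_frobSq A).trans h1) (by positivity)

end Frobenius

/-! ### Matrices whose imaginary part is bounded below -/

section ImaginaryPart

variable {n : Type*} [Fintype n]

/-- The quadratic form `x* M x` of a square matrix. -/
def quadForm (M : Matrix n n ℂ) (x : n → ℂ) : ℂ := star x ⬝ᵥ (M *ᵥ x)

/-- `ImGE c M` says that the Hermitian imaginary part of `M` is at least `c`. -/
def ImGE (c : ℝ) (M : Matrix n n ℂ) : Prop := ∀ x, c * ∑ i, ‖x i‖ ^ 2 ≤ (quadForm M x).im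

lemma quadForm_conjTranspose (M : Matrix n n ℂ) (x : n → ℂ) :
    quadForm Mᴴ x = star (quadForm M x) := by
  rw [quadForm, quadForm, ← star_dotProduct, star_mulVec, ← dotProduct_mulVec]

lemma quadForm_add (M M' : Matrix n n ℂ) (x : n → ℂ) :
    quadForm (M + M') x = quadForm M x + quadForm M' x := by
  simp [quadForm, add_mulVec]

lemma quadForm_sub (M M' : Matrix n n ℂ) (x : n → ℂ) :
    quadForm (M - M') x = quadForm M x - quadForm M' x := by
  simp [quadForm, sub_mulVec]

lemma quadForm_smul (c : ℂ) (M : Matrix n n ℂ) (x : n → ℂ) :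
    quadForm (c • M) x = c * quadForm M x := by
  simp [quadForm, smul_mulVec]

lemma quadForm_sum {ι : Type*} (s : Finset ι) (M : ι → Matrix n n ℂ) (x : n → ℂ) :
    quadForm (∑ i ∈ s, M i) x = ∑ i ∈ s, quadForm (M i) x := by
  simp [quadForm, sum_mulVec, dotProduct_sum]

lemma quadForm_apply (M : Matrix n n ℂ) (x : n → ℂ) :
    quadForm M x = ∑ i, ∑ j, star (x i) * M i j * x j := by
  simp [quadForm, dotProduct, mulVec, Finset.mul_sum, mul_assoc]

lemma quadForm_conj (M A : Matrix n n ℂ) (x : n → ℂ) :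
    quadForm (Aᴴ * M * A) x = quadForm M (A *ᵥ x) := by
  simp only [quadForm, star_mulVec, ← dotProduct_mulVec, mulVec_mulVec, mul_assoc]

lemma im_quadForm_of_isHermitian {M : Matrix n n ℂ} (h : M.IsHermitian) (x : n → ℂ) :
    (quadForm M x).im = 0 := by
  have h1 := quadForm_conjTranspose M x
  rw [h.eq] at h1
  have h2 := congrArg Complex.im h1
  simp at h2
  linarith

lemma star_dotProduct_self (x : n → ℂ) : star x ⬝ᵥ x = ((∑ i, ‖x i‖ ^ 2 : ℝ) : ℂ) := by
  simp [dotProduct, Complex.conj_mul']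

/-- Serves twice: to subtract a Hermitian `Z` from `Λ ⊗ 1`, and to subtract `𝓡ₛ(G)` from `Λ`. In
both cases the lower bound `c` is kept without loss. -/
lemma ImGE.mono_sub {c : ℝ} {M M' : Matrix n n ℂ} (h : ImGE c M)
    (h' : ∀ x, (quadForm M' x).im ≤ 0) : ImGE c (M - M') := fun x => by
  rw [quadForm_sub, Complex.sub_im]
  linarith [h x, h' x]

lemma quadForm_imPart {k : ℕ} (Λ : Matrix (Fin k) (Fin k) ℂ) (x : Fin k → ℂ) :
    quadForm (imPart Λ) x = ((quadForm Λ x).im : ℂ) := by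
  rw [imPart, quadForm_smul, quadForm_sub, quadForm_conjTranspose]
  have : star (quadForm Λ x) = (starRingEnd ℂ) (quadForm Λ x) := rfl
  rw [this, Complex.im_eq_sub_conj]
  field_simp

lemma imPart_isHermitian {k : ℕ} (M : Matrix (Fin k) (Fin k) ℂ) : (imPart M).IsHermitian := by
  simp only [imPart, IsHermitian, conjTranspose_smul, conjTranspose_sub, conjTranspose_conjTranspose]
  rw [← neg_sub M, smul_neg, ← neg_smul]
  congr 1
  simp [Complex.inv_I]

lemma ImGE.mem_upperHalf {k : ℕ} {c : ℝ} (hc : 0 < c) {Λ : Matrix (Fin k) (Fin k) ℂ}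
    (h : ImGE c Λ) : Λ ∈ upperHalf k := by
  refine PosDef.of_dotProduct_mulVec_pos (imPart_isHermitian Λ) fun x hx => ?_
  change 0 < quadForm (imPart Λ) x
  rw [quadForm_imPart]
  have h1 : 0 < ∑ i, ‖x i‖ ^ 2 := by
    obtain ⟨i, hi⟩ := Function.ne_iff.mp hx
    exact Finset.sum_pos' (fun _ _ => by positivity)
      ⟨i, Finset.mem_univ i, by have := norm_pos_iff.mpr hi; positivity⟩
  exact_mod_cast (mul_pos hc h1).trans_le (h x)

/-- Cauchy–Schwarz: `c ‖x‖² ≤ Im ⟨x, M x⟩ ≤ ‖x‖ ‖M x‖`. Injectivity and the bound on the inverse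
both follow. -/
lemma ImGE.mulVec_ge {c : ℝ} {M : Matrix n n ℂ} (h : ImGE c M) (x : EuclideanSpace ℂ n) :
    c * ‖x‖ ≤ ‖WithLp.toLp 2 (M *ᵥ x.ofLp)‖ := by
  rcases (norm_nonneg x).eq_or_lt with h0 | h0
  · rw [← h0, mul_zero]; positivity
  have h1 := h x.ofLp
  rw [← EuclideanSpace.norm_sq_eq] at h1
  have h2 : quadForm M x.ofLp = inner ℂ x (WithLp.toLp 2 (M *ᵥ x.ofLp)) := by
    rw [EuclideanSpace.inner_eq_star_dotProduct, quadForm, dotProduct_comm]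
  have h3 := h1.trans ((Complex.im_le_norm _).trans (h2 ▸ norm_inner_le_norm _ _))
  rw [pow_two, ← mul_assoc, mul_comm ‖x‖] at h3
  exact le_of_mul_le_mul_right h3 h0

variable [DecidableEq n]

-- Writing `M = B* B`, one has `‖M⁻¹‖ = ‖B⁻¹‖²` and `x* M x = ‖B x‖²`, while `‖x‖ ≤ ‖B⁻¹‖ ‖B x‖`.
open scoped MatrixOrder in
lemma PosDef.quadForm_ge {M : Matrix n n ℂ} (hM : M.PosDef) (x : n → ℂ) :
    ‖M⁻¹‖⁻¹ * ∑ i, ‖x i‖ ^ 2 ≤ (quadForm M x).re := by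
  obtain ⟨B, rfl⟩ := CStarAlgebra.nonneg_iff_eq_star_mul_self.mp hM.posSemidef.nonneg
  rw [star_eq_conjTranspose] at *
  have hB : IsUnit B.det := by
    have h := (isUnit_iff_isUnit_det _).mp hM.isUnit
    rw [det_mul] at h
    exact isUnit_of_mul_isUnit_right h
  have h1 : ‖(Bᴴ * B)⁻¹‖ = ‖B⁻¹‖ ^ 2 := by
    rw [Matrix.mul_inv_rev, ← conjTranspose_nonsing_inv, ← l2_opNorm_conjTranspose B⁻¹, pow_two,
      ← l2_opNorm_conjTranspose_mul_self, conjTranspose_conjTranspose]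
  have h2 : quadForm (Bᴴ * B) x = ((∑ i, ‖(B *ᵥ x) i‖ ^ 2 : ℝ) : ℂ) := by
    rw [← star_dotProduct_self, ← mul_one Bᴴ, quadForm_conj, quadForm, one_mulVec]
  rw [h1, h2, Complex.ofReal_re]
  have h3 := sum_norm_sq_mulVec_le B⁻¹ (B *ᵥ x)
  rw [mulVec_mulVec, nonsing_inv_mul _ hB, one_mulVec] at h3
  -- The norm of `B⁻¹` vanishes only for an empty index type. Then `0⁻¹ = 0` makes the left-hand
  -- side zero.
  rcases (norm_nonneg B⁻¹).eq_or_lt with h0 | h0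
  · rw [← h0]
    rw [zero_pow two_ne_zero, _root_.inv_zero, zero_mul]
    positivity
  · rw [inv_mul_le_iff₀ (by positivity)]
    exact h3

/-- Fixes the value of `c` used in the end: its inverse is the norm `‖(Im Λ)⁻¹‖` of the final
estimate. -/
lemma imGE_of_mem_upperHalf {k : ℕ} {Λ : Matrix (Fin k) (Fin k) ℂ} (h : Λ ∈ upperHalf k) :
    ImGE ‖(imPart Λ)⁻¹‖⁻¹ Λ := fun x => by
  simpa [quadForm_imPart] using PosDef.quadForm_ge h x

/-- The place where `k ≥ 1` matters: for `k = 0` the norm is zero and the constant `c` is not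
positive. -/
lemma norm_inv_imPart_pos {k : ℕ} (hk : 1 ≤ k) {Λ : Matrix (Fin k) (Fin k) ℂ}
    (h : Λ ∈ upperHalf k) : 0 < ‖(imPart Λ)⁻¹‖ := by
  have : Nonempty (Fin k) := ⟨⟨0, hk⟩⟩
  rw [norm_pos_iff]
  intro h0
  have h1 := mul_nonsing_inv (imPart Λ) ((isUnit_iff_isUnit_det _).mp (PosDef.isUnit h))
  rw [h0, mul_zero] at h1
  exact zero_ne_one h1

lemma ImGE.isUnit {c : ℝ} (hc : 0 < c) {M : Matrix n n ℂ} (h : ImGE c M) : IsUnit M := by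
  rw [← mulVec_injective_iff_isUnit, ← coe_mulVecLin, ← LinearMap.ker_eq_bot,
    LinearMap.ker_eq_bot']
  intro x hx
  have h1 := h.mulVec_ge (WithLp.toLp 2 x)
  rw [mulVecLin_apply] at hx
  simp only [hx, WithLp.toLp_zero, norm_zero] at h1
  have h2 : ‖WithLp.toLp 2 x‖ ≤ 0 := by
    by_contra! h3
    exact absurd h1 (not_le.mpr (mul_pos hc h3))
  simpa using norm_le_zero_iff.mp h2

lemma ImGE.norm_inv_le {c : ℝ} (hc : 0 < c) {M : Matrix n n ℂ} (h : ImGE c M) :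
    ‖M⁻¹‖ ≤ c⁻¹ := by
  have hu := (isUnit_iff_isUnit_det _).mp (h.isUnit hc)
  rw [l2_opNorm_def]
  refine ContinuousLinearMap.opNorm_le_bound _ (by positivity) fun x => ?_
  have h1 := h.mulVec_ge (WithLp.toLp 2 (M⁻¹ *ᵥ x.ofLp))
  simp only [mulVec_mulVec, mul_nonsing_inv _ hu, one_mulVec] at h1
  rw [inv_mul_eq_div, le_div_iff₀' hc]
  exact h1

/-- With `y = M⁻¹ x` one has `x* M⁻¹ x = (M y)* y`, the conjugate of `y* M y`, so inversion reverses
the sign of the imaginary part. -/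
lemma ImGE.im_quadForm_inv_nonpos {c : ℝ} (hc : 0 < c) {M : Matrix n n ℂ} (h : ImGE c M)
    (x : n → ℂ) : (quadForm M⁻¹ x).im ≤ 0 := by
  have hu := (isUnit_iff_isUnit_det _).mp (h.isUnit hc)
  have h1 : quadForm M⁻¹ x = star (quadForm M (M⁻¹ *ᵥ x)) := by
    rw [← quadForm_conjTranspose, ← quadForm_conj, conjTranspose_nonsing_inv, nonsing_inv_mul,
      one_mul]
    rwa [← isUnit_iff_isUnit_det, isUnit_conjTranspose, isUnit_iff_isUnit_det]
  rw [h1]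
  have h2 := h (M⁻¹ *ᵥ x)
  have h3 : 0 ≤ ∑ i, ‖(M⁻¹ *ᵥ x) i‖ ^ 2 := by positivity
  have h4 : (star (quadForm M (M⁻¹ *ᵥ x))).im = -(quadForm M (M⁻¹ *ᵥ x)).im := Complex.conj_im _
  rw [h4]
  nlinarith

end ImaginaryPart

/-! ### Tensor products with the identity and partial traces -/

section Blocks

variable {k N : ℕ}

lemma quadForm_kronecker_one (Λ : Matrix (Fin k) (Fin k) ℂ) (x : Fin k × Fin N → ℂ) :
    quadForm (Λ ⊗ₖ (1 : Matrix (Fin N) (Fin N) ℂ)) x = ∑ n, quadForm Λ fun u => x (u, n) := by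
  simp only [quadForm_apply, Fintype.sum_prod_type, kroneckerMap_apply, one_apply]
  rw [Finset.sum_comm]
  refine Finset.sum_congr rfl fun n _ => Finset.sum_congr rfl fun u _ => Finset.sum_congr rfl fun v _ => ?_
  simp

lemma ImGE.shifted {c : ℝ} {Λ : Matrix (Fin k) (Fin k) ℂ} (h : ImGE c Λ)
    {Z : Matrix (Fin k × Fin N) (Fin k × Fin N) ℂ} (hZ : Z.IsHermitian) :
    ImGE c (shifted Λ Z) := by
  refine ImGE.mono_sub (fun x => ?_) fun x => (im_quadForm_of_isHermitian hZ x).le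
  rw [quadForm_kronecker_one, Complex.im_sum, Fintype.sum_prod_type, Finset.sum_comm,
    Finset.mul_sum]
  exact Finset.sum_le_sum fun n _ => h _

/-- The vectors on the right are `x ⊗ eₙ`: a partial trace is an average of compressions, and
therefore inherits the sign of the imaginary part. -/
lemma quadForm_partialTrace (M : Matrix (Fin k × Fin N) (Fin k × Fin N) ℂ) (x : Fin k → ℂ) :
    quadForm (partialTrace M) x
      = (N : ℂ)⁻¹ * ∑ n, quadForm M fun i => if i.2 = n then x i.1 else 0 := by
  have h1 : ∀ n, quadForm M (fun i => if i.2 = n then x i.1 else 0)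
      = ∑ u, ∑ v, star (x u) * M (u, n) (v, n) * x v := fun n => by
    simp [quadForm_apply, Fintype.sum_prod_type, apply_ite (starRingEnd ℂ)]
  simp only [h1, quadForm_apply, partialTrace, of_apply]
  rw [Finset.sum_comm (s := (Finset.univ : Finset (Fin N))), Finset.mul_sum]
  refine Finset.sum_congr rfl fun u _ => ?_
  rw [Finset.sum_comm, Finset.mul_sum]
  refine Finset.sum_congr rfl fun v _ => ?_
  rw [Finset.mul_sum, Finset.mul_sum, Finset.mul_sum, Finset.sum_mul]
  exact Finset.sum_congr rfl fun n _ => by ring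

lemma im_quadForm_partialTrace_nonpos {M : Matrix (Fin k × Fin N) (Fin k × Fin N) ℂ}
    (h : ∀ x, (quadForm M x).im ≤ 0) (x : Fin k → ℂ) : (quadForm (partialTrace M) x).im ≤ 0 := by
  rw [quadForm_partialTrace, ← Complex.ofReal_natCast, ← Complex.ofReal_inv,
    Complex.im_ofReal_mul, Complex.im_sum]
  exact mul_nonpos_of_nonneg_of_nonpos (by positivity) (Finset.sum_nonpos fun n _ => h _)

lemma im_quadForm_covMap_nonpos {p : ℕ} {a : Fin p → Matrix (Fin k) (Fin k) ℂ}
    (ha : ∀ j, (a j).IsHermitian) {M : Matrix (Fin k) (Fin k) ℂ}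
    (h : ∀ x, (quadForm M x).im ≤ 0) (x : Fin k → ℂ) : (quadForm (covMap a M) x).im ≤ 0 := by
  rw [covMap, quadForm_sum, Complex.im_sum]
  refine Finset.sum_nonpos fun j _ => ?_
  have := quadForm_conj M (a j) x
  rw [(ha j).eq] at this
  rw [this]
  exact h _

/-- The map `A ↦ A ⊗ 1` is a homomorphism of C*-algebras, and such maps are contractions. -/
lemma norm_kronecker_one_le (A : Matrix (Fin k) (Fin k) ℂ) :
    ‖A ⊗ₖ (1 : Matrix (Fin N) (Fin N) ℂ)‖ ≤ ‖A‖ := by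
  let φ : Matrix (Fin k) (Fin k) ℂ →⋆ₙₐ[ℂ] Matrix (Fin k × Fin N) (Fin k × Fin N) ℂ :=
    { toFun := fun A => A ⊗ₖ 1
      map_smul' := fun c A => smul_kronecker c A 1
      map_zero' := zero_kronecker 1
      map_add' := fun A B => add_kronecker A B 1
      map_mul' := fun A B => by rw [← mul_kronecker_mul, one_mul]
      map_star' := fun A => by
        rw [star_eq_conjTranspose, star_eq_conjTranspose, conjTranspose_kronecker,
          conjTranspose_one] }
  exact NonUnitalStarAlgHom.norm_apply_le φ A

end Blocks

/-! ### Hermitian frames: Parseval identity and contraction formula -/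

/-- A Parseval frame, for the Frobenius inner product, of the real space of Hermitian matrices. -/
structure IsHermitianFrame {ι : Type*} [Fintype ι] {N : ℕ} (E : ι → Matrix (Fin N) (Fin N) ℂ) :
    Prop where
  isHermitian : ∀ i, (E i).IsHermitian
  sum_mul : ∀ a b c d, ∑ i, E i a b * E i c d = if a = d ∧ b = c then 1 else 0

section Frames

variable {ι : Type*} [Fintype ι] {k N p : ℕ} {E : ι → Matrix (Fin N) (Fin N) ℂ}

/-- The completeness relation `∑ᵢ Eᵢ ⊗ Eᵢ = flip` is bilinear over `ℂ`, so Parseval holds for every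
complex `M`, not just Hermitian ones. Hermiticity of `Eᵢ` serves to rewrite the conjugate of `Tr(Eᵢ
M)` as a linear expression in the entries of `Eᵢ`. -/
lemma IsHermitianFrame.sum_norm_sq_trace (hE : IsHermitianFrame E) (M : Matrix (Fin N) (Fin N) ℂ) :
    ∑ i, ‖trace (E i * M)‖ ^ 2 = frobSq M := by
  have h1 : ∀ i, ((‖trace (E i * M)‖ ^ 2 : ℝ) : ℂ)
      = ∑ a, ∑ b, ∑ c, ∑ d, E i a b * E i d c * (M b a * star (M d c)) := fun i => by
    have h2 : trace (E i * M) = ∑ a, ∑ b, E i a b * M b a := by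
      simp [trace, mul_apply]
    have h3 : star (trace (E i * M)) = ∑ c, ∑ d, E i d c * star (M d c) := by
      rw [h2, star_sum]
      refine Finset.sum_congr rfl fun c _ => ?_
      rw [star_sum]
      refine Finset.sum_congr rfl fun d _ => ?_
      rw [star_mul', (hE.isHermitian i).apply]
    have h4 : ((‖trace (E i * M)‖ ^ 2 : ℝ) : ℂ) = star (trace (E i * M)) * trace (E i * M) := by
      rw [Complex.ofReal_pow, ← Complex.conj_mul']
      rfl
    rw [h4, h3, h2]
    simp only [Finset.sum_mul, Finset.mul_sum]
    refine Finset.sum_congr rfl fun a _ => Finset.sum_congr rfl fun b _ =>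
      Finset.sum_congr rfl fun c _ => Finset.sum_congr rfl fun d _ => by ring
  have h5 : ((∑ i, ‖trace (E i * M)‖ ^ 2 : ℝ) : ℂ) = (frobSq M : ℝ) := by
    rw [Complex.ofReal_sum, Finset.sum_congr rfl fun i _ => h1 i, Finset.sum_comm]
    have h6 : ∀ a, ∑ i, ∑ b, ∑ c, ∑ d, E i a b * E i d c * (M b a * star (M d c))
        = ∑ b, ((‖M b a‖ ^ 2 : ℝ) : ℂ) := fun a => by
      rw [Finset.sum_comm]
      refine Finset.sum_congr rfl fun b _ => ?_
      rw [Finset.sum_comm]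
      have h7 : ∀ c, ∑ i, ∑ d, E i a b * E i d c * (M b a * star (M d c))
          = if a = c then ((‖M b a‖ ^ 2 : ℝ) : ℂ) else 0 := fun c => by
        rw [Finset.sum_comm]
        simp_rw [← Finset.sum_mul, hE.sum_mul]
        by_cases hac : a = c
        · subst hac
          simp [Complex.mul_conj']
        · simp [hac]
      rw [Finset.sum_congr rfl fun c _ => h7 c]
      simp
    simp only [h6]
    rw [frobSq, Finset.sum_comm]
    simp
  exact_mod_cast h5

/-- The partial trace `Tr_k ⊗ id`. -/
def partialTraceLeft (C : Matrix (Fin k × Fin N) (Fin k × Fin N) ℂ) : Matrix (Fin N) (Fin N) ℂ :=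
  Matrix.of fun m n => ∑ w, C (w, m) (w, n)

/-- Cauchy–Schwarz over the `k` diagonal blocks; the off-diagonal blocks are discarded. -/
lemma frobSq_partialTraceLeft_le (C : Matrix (Fin k × Fin N) (Fin k × Fin N) ℂ) :
    frobSq (partialTraceLeft C) ≤ k * frobSq C := by
  have h1 : ∀ m n, ‖partialTraceLeft C m n‖ ^ 2 ≤ k * ∑ w, ‖C (w, m) (w, n)‖ ^ 2 := fun m n => by
    refine (pow_le_pow_left₀ (norm_nonneg (∑ w, C (w, m) (w, n))) (norm_sum_le _ _) 2).trans ?_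
    simpa using sq_sum_le_card_mul_sum_sq (s := (Finset.univ : Finset (Fin k)))
      (f := fun w => ‖C (w, m) (w, n)‖)
  calc frobSq (partialTraceLeft C) ≤ ∑ m, ∑ n, k * ∑ w, ‖C (w, m) (w, n)‖ ^ 2 :=
        Finset.sum_le_sum fun m _ => Finset.sum_le_sum fun n _ => h1 m n
    _ = k * ∑ w, ∑ m, ∑ n, ‖C (w, m) (w, n)‖ ^ 2 := by
        simp_rw [← Finset.mul_sum]
        congr 1
        rw [Finset.sum_comm (s := (Finset.univ : Finset (Fin k)))]
        exact Finset.sum_congr rfl fun m _ => Finset.sum_comm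
    _ ≤ k * frobSq C := by
        refine mul_le_mul_of_nonneg_left ?_ (Nat.cast_nonneg _)
        simp only [frobSq, Fintype.sum_prod_type]
        refine Finset.sum_le_sum fun w _ => Finset.sum_le_sum fun m _ => ?_
        exact Finset.single_le_sum (f := fun w' => ∑ n, ‖C (w, m) (w', n)‖ ^ 2)
          (fun _ _ => by positivity) (Finset.mem_univ w)

lemma trace_one_kronecker_mul (e : Matrix (Fin N) (Fin N) ℂ)
    (C : Matrix (Fin k × Fin N) (Fin k × Fin N) ℂ) :
    trace (((1 : Matrix (Fin k) (Fin k) ℂ) ⊗ₖ e) * C) = trace (e * partialTraceLeft C) := by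
  simp only [trace, diag_apply, mul_apply, Fintype.sum_prod_type, kroneckerMap_apply, one_apply,
    partialTraceLeft, of_apply, Finset.mul_sum]
  rw [Finset.sum_comm]
  refine Finset.sum_congr rfl fun m _ => ?_
  rw [Finset.sum_comm (s := (Finset.univ : Finset (Fin N)))]
  refine Finset.sum_congr rfl fun w _ => ?_
  rw [Finset.sum_eq_single w] <;> simp +contextual [eq_comm]

lemma partialTrace_eq_trace (X : Matrix (Fin k × Fin N) (Fin k × Fin N) ℂ) (u v : Fin k) :
    partialTrace X u v
      = (N : ℂ)⁻¹ * trace ((single v u (1 : ℂ) ⊗ₖ (1 : Matrix (Fin N) (Fin N) ℂ)) * X) := by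
  simp only [partialTrace, of_apply]
  congr 1
  simp only [trace, diag_apply, mul_apply, Fintype.sum_prod_type, kroneckerMap_apply, one_apply,
    single_apply]
  rw [Finset.sum_eq_single v, Finset.sum_congr rfl]
  · intro n _
    rw [Finset.sum_eq_single u, Finset.sum_eq_single n]
    all_goals simp +contextual [eq_comm]
  all_goals simp +contextual [eq_comm]

/-- The source of one factor `1/N` in each variance. The entry is `N⁻¹ Tr(Eᵢ C')` with `C'` the left
partial trace of `B J A (a ⊗ 1)`, so Parseval gives `N⁻² ‖C'‖²` in Frobenius norm. The only factor
measured in Frobenius norm is `J = e_{vu} ⊗ 1`, which contributes `N`; the others enter through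
their operator norms, and the partial trace costs `k`. -/
lemma IsHermitianFrame.sum_norm_sq_partialTrace_le (hE : IsHermitianFrame E) (hN : 1 ≤ N)
    (A B : Matrix (Fin k × Fin N) (Fin k × Fin N) ℂ) (a : Matrix (Fin k) (Fin k) ℂ)
    (u v : Fin k) :
    ∑ i, ‖partialTrace (A * (a ⊗ₖ E i) * B) u v‖ ^ 2 ≤ k / N * (‖A‖ * ‖B‖) ^ 2 * ‖a‖ ^ 2 := by
  set J : Matrix (Fin k × Fin N) (Fin k × Fin N) ℂ := single v u (1 : ℂ) ⊗ₖ 1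
  set a' : Matrix (Fin k × Fin N) (Fin k × Fin N) ℂ := a ⊗ₖ 1
  have h1 : ∀ i, partialTrace (A * (a ⊗ₖ E i) * B) u v
      = (N : ℂ)⁻¹ * trace (E i * partialTraceLeft (B * J * A * a')) := fun i => by
    have h2 : a ⊗ₖ E i = a' * ((1 : Matrix (Fin k) (Fin k) ℂ) ⊗ₖ E i) := by
      rw [← mul_kronecker_mul, mul_one, one_mul]
    rw [partialTrace_eq_trace, ← trace_one_kronecker_mul, h2]
    congr 1
    rw [trace_mul_comm (_ ⊗ₖ E i), ← mul_assoc, ← mul_assoc, ← mul_assoc, trace_mul_comm]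
    simp only [mul_assoc]
    rfl
  have hJ : frobSq J ≤ N := by
    refine le_of_eq ?_
    simp only [frobSq, J, Fintype.sum_prod_type, kroneckerMap_apply, one_apply, single_apply]
    rw [Finset.sum_eq_single v, Finset.sum_congr rfl (g := fun _ => (1 : ℝ))]
    · simp
    · intro n _
      rw [Finset.sum_eq_single u, Finset.sum_eq_single n]
      all_goals simp +contextual [eq_comm]
    all_goals simp +contextual [eq_comm]
  have hC : frobSq (B * J * A * a') ≤ ‖B‖ ^ 2 * N * ‖A‖ ^ 2 * ‖a‖ ^ 2 := by
    have ha' : ‖a'‖ ^ 2 ≤ ‖a‖ ^ 2 := pow_le_pow_left₀ (norm_nonneg _) (norm_kronecker_one_le a) 2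
    have hf : ∀ X : Matrix (Fin k × Fin N) (Fin k × Fin N) ℂ, 0 ≤ frobSq X := fun X => by
      unfold frobSq; positivity
    have h3 := frobSq_mul_le_left B J
    have h4 := frobSq_mul_le_right (B * J) A
    have h5 := frobSq_mul_le_right (B * J * A) a'
    calc _ ≤ _ := h5
      _ ≤ frobSq (B * J * A) * ‖a‖ ^ 2 := by gcongr; exact hf _
      _ ≤ frobSq (B * J) * ‖A‖ ^ 2 * ‖a‖ ^ 2 := by gcongr
      _ ≤ ‖B‖ ^ 2 * frobSq J * ‖A‖ ^ 2 * ‖a‖ ^ 2 := by gcongr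
      _ ≤ ‖B‖ ^ 2 * N * ‖A‖ ^ 2 * ‖a‖ ^ 2 := by gcongr
  have hN' : (0 : ℝ) < N := by exact_mod_cast hN
  simp only [h1, norm_mul, norm_inv, mul_pow, ← Finset.mul_sum, hE.sum_norm_sq_trace,
    Complex.norm_natCast]
  calc ((N : ℝ)⁻¹) ^ 2 * frobSq (partialTraceLeft (B * J * A * a'))
      ≤ ((N : ℝ)⁻¹) ^ 2 * (k * (‖B‖ ^ 2 * N * ‖A‖ ^ 2 * ‖a‖ ^ 2)) := by
        gcongr
        exact (frobSq_partialTraceLeft_le _).trans (by gcongr)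
    _ = _ := by field_simp

/-- Contracting with `∑ᵢ Eᵢ ⊗ Eᵢ = flip` replaces `∑ᵢ Eᵢ b Eᵢ` by `Tr(b) 1` on the `N × N` factor.
This is how `𝓡ₛ` and the partial trace appear; the factor `N` cancels the covariance `1/N`. -/
lemma IsHermitianFrame.sum_kronecker_mul_mul (hE : IsHermitianFrame E) (hN : 1 ≤ N)
    (B : Matrix (Fin k × Fin N) (Fin k × Fin N) ℂ) (a : Matrix (Fin k) (Fin k) ℂ) :
    ∑ i, (a ⊗ₖ E i) * B * (a ⊗ₖ E i)
      = (N : ℂ) • ((a * partialTrace B * a) ⊗ₖ (1 : Matrix (Fin N) (Fin N) ℂ)) := by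
  have hN' : (N : ℂ) ≠ 0 := by exact_mod_cast (by omega : N ≠ 0)
  ext ⟨w, m⟩ ⟨w', m'⟩
  have h1 : ∀ i, ((a ⊗ₖ E i) * B * (a ⊗ₖ E i)) (w, m) (w', m')
      = ∑ v', ∑ n', ∑ v, ∑ n, E i m n * E i n' m' * (a w v * B (v, n) (v', n') * a v' w') :=
    fun i => by
      simp only [mul_apply, Fintype.sum_prod_type, kroneckerMap_apply, Finset.sum_mul]
      refine Finset.sum_congr rfl fun v' _ => Finset.sum_congr rfl fun n' _ =>
        Finset.sum_congr rfl fun v _ => Finset.sum_congr rfl fun n _ => by ring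
  rw [Matrix.sum_apply, Finset.sum_congr rfl fun i _ => h1 i, Finset.sum_comm]
  have h2 : ∀ v', ∑ i, ∑ n', ∑ v, ∑ n,
        E i m n * E i n' m' * (a w v * B (v, n) (v', n') * a v' w')
      = ∑ n', ∑ v, if m = m' then a w v * B (v, n') (v', n') * a v' w' else 0 := fun v' => by
    rw [Finset.sum_comm]
    refine Finset.sum_congr rfl fun n' _ => ?_
    rw [Finset.sum_comm]
    refine Finset.sum_congr rfl fun v _ => ?_
    rw [Finset.sum_comm]
    simp_rw [← Finset.sum_mul, hE.sum_mul]
    by_cases hm : m = m' <;> simp [hm]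
  rw [Finset.sum_congr rfl fun v' _ => h2 v']
  simp only [Matrix.smul_apply, kroneckerMap_apply, one_apply, smul_eq_mul, mul_apply, partialTrace,
    of_apply]
  by_cases hm : m = m'
  · simp only [hm, if_true, mul_one, Finset.mul_sum, Finset.sum_mul]
    refine Finset.sum_congr rfl fun v' _ => ?_
    rw [Finset.sum_comm]
    refine Finset.sum_congr rfl fun v _ => Finset.sum_congr rfl fun n _ => ?_
    field_simp
  · simp [hm]

end Frames

/-- The block matrices `aⱼ ⊗ Eᵢ`. -/
def blockFrame {ι : Type*} {k N p : ℕ} (a : Fin p → Matrix (Fin k) (Fin k) ℂ)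
    (E : ι → Matrix (Fin N) (Fin N) ℂ) (i : Fin p × ι) :
    Matrix (Fin k × Fin N) (Fin k × Fin N) ℂ := a i.1 ⊗ₖ E i.2

section BlockFrames

variable {ι : Type*} [Fintype ι] {k N p : ℕ} {E : ι → Matrix (Fin N) (Fin N) ℂ}
  {a : Fin p → Matrix (Fin k) (Fin k) ℂ}

lemma isHermitian_blockFrame (hE : IsHermitianFrame E) (ha : ∀ j, (a j).IsHermitian)
    (i : Fin p × ι) : (blockFrame a E i).IsHermitian := by
  rw [blockFrame, IsHermitian, conjTranspose_kronecker, (ha _).eq, (hE.isHermitian _).eq]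

lemma sum_blockFrame_norm_sq_partialTrace_le (hE : IsHermitianFrame E) (hN : 1 ≤ N)
    (A B : Matrix (Fin k × Fin N) (Fin k × Fin N) ℂ) (u v : Fin k) :
    ∑ i, ‖partialTrace (A * blockFrame a E i * B) u v‖ ^ 2
      ≤ k / N * (‖A‖ * ‖B‖) ^ 2 * ∑ j, ‖a j‖ ^ 2 := by
  rw [Fintype.sum_prod_type, Finset.mul_sum]
  exact Finset.sum_le_sum fun j _ => hE.sum_norm_sq_partialTrace_le hN A B (a j) u v

lemma sum_blockFrame_mul_mul (hE : IsHermitianFrame E) (hN : 1 ≤ N)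
    (B : Matrix (Fin k × Fin N) (Fin k × Fin N) ℂ) :
    ∑ i, blockFrame a E i * B * blockFrame a E i
      = (N : ℂ) • (covMap a (partialTrace B) ⊗ₖ (1 : Matrix (Fin N) (Fin N) ℂ)) := by
  rw [Fintype.sum_prod_type, covMap]
  simp only [blockFrame, hE.sum_kronecker_mul_mul hN]
  rw [← Finset.smul_sum]
  congr 1
  ext i j
  simp [Matrix.sum_apply, kroneckerMap_apply, Finset.sum_mul]

end BlockFrames

/-! ### Gaussian integration by parts -/

section IntegrationByParts

variable {E : Type*} [NormedAddCommGroup E] [NormedSpace ℝ E]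

lemma hasDerivAt_gaussianPDFReal {s : NNReal} (hs : s ≠ 0) (x : ℝ) :
    HasDerivAt (gaussianPDFReal 0 s) (-(x / s) * gaussianPDFReal 0 s x) x := by
  have hs' : (s : ℝ) ≠ 0 := by exact_mod_cast hs
  have h1 : HasDerivAt (fun x : ℝ => -(x - 0) ^ 2 / (2 * s)) (-(x / s)) x := by
    have h2 := (((hasDerivAt_id x).sub_const 0).pow 2).neg.div_const (2 * (s : ℝ))
    refine h2.congr_deriv ?_
    simp
    field_simp
  rw [gaussianPDFReal_def]
  refine (h1.exp.const_mul _).congr_deriv ?_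
  ring

/-- **Gaussian integration by parts** in dimension one. -/
lemma integral_smul_gaussianReal {s : NNReal} (hs : s ≠ 0) {f f' : ℝ → E}
    (hf : ∀ x, HasDerivAt f (f' x) x) (hf' : Continuous f') {C C' : ℝ}
    (hC : ∀ x, ‖f x‖ ≤ C) (hC' : ∀ x, ‖f' x‖ ≤ C') :
    ∫ x, x • f x ∂gaussianReal 0 s = (s : ℝ) • ∫ x, f' x ∂gaussianReal 0 s := by
  have hs' : (s : ℝ) ≠ 0 := by exact_mod_cast hs
  have hfc : Continuous f := continuous_iff_continuousAt.mpr fun x => (hf x).continuousAt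
  have hp := integrable_gaussianPDFReal 0 s
  have hxp : Integrable fun x : ℝ => -(x / s) * gaussianPDFReal 0 s x := by
    have h1 : Integrable (fun x : ℝ => x) (gaussianReal 0 s) :=
      (memLp_id_gaussianReal 1).integrable (by simp)
    rw [gaussianReal_of_var_ne_zero 0 hs, integrable_withDensity_iff_integrable_smul'
      (measurable_gaussianPDF 0 s) (by simp [gaussianPDF])] at h1
    refine (h1.const_mul (-(s : ℝ)⁻¹)).congr (ae_of_all _ fun x => ?_)
    simp [toReal_gaussianPDF, div_eq_mul_inv]
    ring
  rw [integral_gaussianReal_eq_integral_smul hs, integral_gaussianReal_eq_integral_smul hs]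
  have h2 := integral_bilinear_hasDerivAt_right_eq_neg_left_of_integrable
    (L := ContinuousLinearMap.lsmul ℝ ℝ (E := E)) (u := gaussianPDFReal 0 s) (v := f)
    (fun x _ => hasDerivAt_gaussianPDFReal hs x) (fun x _ => hf x)
    (hp.smul_bdd C' hf'.aestronglyMeasurable (ae_of_all _ hC'))
    (hxp.smul_bdd C hfc.aestronglyMeasurable (ae_of_all _ hC))
    (hp.smul_bdd C hfc.aestronglyMeasurable (ae_of_all _ hC))
  simp only [ContinuousLinearMap.lsmul_apply] at h2
  rw [h2, ← integral_neg, ← integral_smul]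
  refine integral_congr_ae (ae_of_all _ fun x => ?_)
  simp only [smul_smul, neg_mul, neg_smul, neg_neg, ← smul_neg]
  congr 1
  field_simp

variable {ι : Type*} [Fintype ι] [DecidableEq ι]

/-- Resampling one coordinate independently leaves a product law unchanged. This isolates a single
variable and reduces the formula in dimension `n` to dimension one, without splitting the index set.
-/
lemma measurePreserving_update (μ : ι → Measure ℝ) [∀ i, IsProbabilityMeasure (μ i)] (i : ι) :
    MeasurePreserving (fun z : (ι → ℝ) × ℝ => Function.update z.1 i z.2)
      ((Measure.pi μ).prod (μ i)) (Measure.pi μ) := by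
  have hm : Measurable fun z : (ι → ℝ) × ℝ => Function.update z.1 i z.2 := by
    refine measurable_pi_iff.mpr fun j => ?_
    by_cases h : j = i
    · subst h; simpa using measurable_snd
    · simp only [Function.update_of_ne h]; fun_prop
  refine ⟨hm, (Measure.pi_eq fun t ht => ?_).symm⟩
  rw [Measure.map_apply hm (MeasurableSet.univ_pi ht)]
  have h1 : (fun z : (ι → ℝ) × ℝ => Function.update z.1 i z.2) ⁻¹' Set.univ.pi t
      = (Set.univ.pi (Function.update t i Set.univ)) ×ˢ t i := by
    ext ⟨x, y⟩
    simp only [Set.mem_preimage, Set.mem_univ_pi, Set.mem_prod]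
    constructor
    · refine fun h => ⟨fun j => ?_, by simpa using h i⟩
      by_cases hj : j = i
      · subst hj; simp
      · simpa [hj] using h j
    · rintro ⟨h, h'⟩ j
      by_cases hj : j = i
      · subst hj; simpa using h'
      · simpa [hj] using h j
  rw [h1, Measure.prod_prod, Measure.pi_pi, ← Finset.mul_prod_erase _ _ (Finset.mem_univ i),
    ← Finset.mul_prod_erase _ (fun j => μ j (t j)) (Finset.mem_univ i)]
  simp only [Function.update_self, measure_univ, one_mul]
  rw [mul_comm]
  congr 1
  refine Finset.prod_congr rfl fun j hj => ?_
  rw [Function.update_of_ne (Finset.ne_of_mem_erase hj)]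

lemma integral_pi_eq_integral_update (μ : ι → Measure ℝ) [∀ i, IsProbabilityMeasure (μ i)] (i : ι)
    {f : (ι → ℝ) → E} (hf : Integrable f (Measure.pi μ)) :
    ∫ x, f x ∂Measure.pi μ
      = ∫ x, ∫ t, f (Function.update x i t) ∂(μ i) ∂Measure.pi μ := by
  have h := measurePreserving_update μ i
  rw [← h.map_eq] at hf
  conv_lhs => rw [← h.map_eq, integral_map h.measurable.aemeasurable hf.aestronglyMeasurable]
  exact integral_prod _ (hf.comp_measurable h.measurable)

/-- The centered Gaussian law on `ℝ^ι` with covariance matrix `s • 1`. -/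
def gaussianPi (ι : Type*) [Fintype ι] (s : NNReal) : Measure (ι → ℝ) :=
  Measure.pi fun _ => gaussianReal 0 s

instance (s : NNReal) : IsProbabilityMeasure (gaussianPi ι s) := by
  unfold gaussianPi; infer_instance

lemma integrable_eval_gaussianPi (s : NNReal) (i : ι) :
    Integrable (fun x : ι → ℝ => x i) (gaussianPi ι s) := by
  have h1 : Integrable (fun x : ℝ => x) (gaussianReal 0 s) :=
    (memLp_id_gaussianReal 1).integrable (by simp)
  exact (measurePreserving_eval (fun _ : ι => gaussianReal 0 s) i).integrable_comp_of_integrable h1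

lemma integrable_of_continuous_of_bound {α : Type*} [TopologicalSpace α] [MeasurableSpace α]
    [OpensMeasurableSpace α] [SecondCountableTopology α] {μ : Measure α} [IsFiniteMeasure μ]
    {f : α → E} (hf : Continuous f) {C : ℝ} (hC : ∀ x, ‖f x‖ ≤ C) : Integrable f μ :=
  Integrable.of_bound hf.aestronglyMeasurable C (ae_of_all _ hC)

/-- **Gaussian integration by parts** in finite dimension. -/
lemma integral_smul_gaussianPi {s : NNReal} (hs : s ≠ 0) (i : ι) {f : (ι → ℝ) → E}
    (hf : ContDiff ℝ 1 f) {C C' : ℝ} (hC : ∀ x, ‖f x‖ ≤ C)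
    (hC' : ∀ x, ‖fderiv ℝ f x (Pi.single i 1)‖ ≤ C') :
    ∫ x, x i • f x ∂gaussianPi ι s
      = (s : ℝ) • ∫ x, fderiv ℝ f x (Pi.single i 1) ∂gaussianPi ι s := by
  have hfc : Continuous fun x => fderiv ℝ f x (Pi.single i 1) :=
    (hf.continuous_fderiv one_ne_zero).clm_apply continuous_const
  have h1 : Integrable (fun x : ι → ℝ => x i • f x) (gaussianPi ι s) :=
    (integrable_eval_gaussianPi s i).smul_bdd C hf.continuous.aestronglyMeasurable
      (ae_of_all _ hC)
  have h2 : Integrable (fun x => fderiv ℝ f x (Pi.single i 1)) (gaussianPi ι s) :=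
    integrable_of_continuous_of_bound hfc hC'
  unfold gaussianPi at h1 h2 ⊢
  rw [integral_pi_eq_integral_update _ i h1, integral_pi_eq_integral_update _ i h2,
    ← integral_smul]
  refine integral_congr_ae (ae_of_all _ fun x => ?_)
  simp only [Function.update_self]
  refine integral_smul_gaussianReal hs (fun t => ?_) (hfc.comp (by fun_prop)) (fun t => hC _)
    fun t => hC' _
  exact ((hf.differentiable one_ne_zero _).hasFDerivAt).comp_hasDerivAt t (hasDerivAt_update x i t)

end IntegrationByParts

/-! ### Variance of complex functions -/

section Variance

variable {α : Type*} [MeasurableSpace α] {μ : Measure α} [IsProbabilityMeasure μ]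

/-- Bias–variance decomposition. It is applied with `c` a value of `f` for symmetrization, with `c =
0` for Jensen's inequality, and with `c` a global mean for tensorization. -/
lemma integral_norm_sub_sq {f : α → ℂ} (hf : Integrable f μ)
    (hf2 : Integrable (fun x => ‖f x‖ ^ 2) μ) (c : ℂ) :
    ∫ x, ‖f x - c‖ ^ 2 ∂μ = ∫ x, ‖f x - ∫ y, f y ∂μ‖ ^ 2 ∂μ + ‖∫ y, f y ∂μ - c‖ ^ 2 := by
  have h1 : ∀ d : ℂ, ∫ x, ‖f x - d‖ ^ 2 ∂μ
      = ∫ x, ‖f x‖ ^ 2 ∂μ + ‖d‖ ^ 2 - 2 * ((∫ y, f y ∂μ) * (starRingEnd ℂ) d).re := fun d => by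
    have h2 : ∀ x, ‖f x - d‖ ^ 2 = ‖f x‖ ^ 2 + ‖d‖ ^ 2 - 2 * (f x * (starRingEnd ℂ) d).re :=
      fun x => by
        simp only [← Complex.normSq_eq_norm_sq]
        exact Complex.normSq_sub _ _
    have h3 : Integrable (fun x => f x * (starRingEnd ℂ) d) μ := hf.mul_const _
    have h3' : Integrable (fun x => 2 * (f x * (starRingEnd ℂ) d).re) μ := h3.re.const_mul 2
    have h6 : Integrable (fun x => ‖f x‖ ^ 2 + ‖d‖ ^ 2) μ := hf2.add (integrable_const _)
    have h4 : ∫ x, (f x * (starRingEnd ℂ) d).re ∂μ = ((∫ y, f y ∂μ) * (starRingEnd ℂ) d).re := by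
      rw [← integral_mul_const]
      exact integral_re h3
    simp only [h2]
    rw [integral_sub h6 h3', integral_const_mul, h4, integral_add hf2 (integrable_const _)]
    simp
  rw [h1 c, h1, ← Complex.normSq_eq_norm_sq (_ - c), Complex.normSq_sub, Complex.mul_conj]
  simp only [Complex.normSq_eq_norm_sq, Complex.ofReal_re]
  ring

end Variance

/-! ### Poincaré inequalities: Gaussian case and tensorization -/

section Poincare

variable {ι : Type*} [Fintype ι] [DecidableEq ι]

/-- Gives access to the invariance of the product of two copies of a centered Gaussian law under
rotations. -/
lemma isGaussian_gaussianPi (s : NNReal) : IsGaussian (gaussianPi ι s) := by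
  have h1 : iIndepFun (fun i (x : ι → ℝ) => x i) (gaussianPi ι s) :=
    iIndepFun_pi (μ := fun _ : ι => gaussianReal 0 s) (X := fun _ x => x) fun _ => aemeasurable_id
  have h2 : ∀ i, HasGaussianLaw (fun x : ι → ℝ => x i) (gaussianPi ι s) := fun i => by
    have h : Measure.map (fun x : ι → ℝ => x i) (gaussianPi ι s) = gaussianReal 0 s :=
      (measurePreserving_eval (fun _ : ι => gaussianReal 0 s) i).map_eq
    exact ⟨h ▸ isGaussian_gaussianReal 0 s⟩
  have h3 := (iIndepFun.hasGaussianLaw h2 h1).isGaussian_map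
  have h4 : (fun (ω : ι → ℝ) x => ω x) = id := rfl
  rwa [h4, Measure.map_id] at h3

lemma integral_eval_gaussianPi (s : NNReal) (i : ι) : ∫ x, x i ∂gaussianPi ι s = 0 := by
  have h := measurePreserving_eval (fun _ : ι => gaussianReal 0 s) i
  have h1 : ∫ x, x i ∂gaussianPi ι s = ∫ t, t ∂gaussianReal 0 s := by
    rw [← h.map_eq, integral_map h.measurable.aemeasurable (by fun_prop)]
    rfl
  rw [h1, integral_id_gaussianReal]

lemma memLp_eval_gaussianPi (s : NNReal) (i : ι) :
    MemLp (fun x : ι → ℝ => x i) 2 (gaussianPi ι s) :=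
  (memLp_id_gaussianReal (μ := 0) (v := s) 2).comp_measurePreserving
    (measurePreserving_eval (fun _ : ι => gaussianReal 0 s) i)

lemma integral_eval_mul_eval_gaussianPi (s : NNReal) (i j : ι) :
    ∫ x, x i * x j ∂gaussianPi ι s = if i = j then (s : ℝ) else 0 := by
  split_ifs with hij
  · subst hij
    have h := measurePreserving_eval (fun _ : ι => gaussianReal 0 s) i
    have h1 : ∫ x, x i * x i ∂gaussianPi ι s = ∫ t, t * t ∂gaussianReal 0 s := by
      rw [← h.map_eq, integral_map h.measurable.aemeasurable (by fun_prop)]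
      rfl
    have h2 := variance_of_integral_eq_zero (X := id) (μ := gaussianReal 0 s) aemeasurable_id
      (by simp)
    rw [variance_id_gaussianReal] at h2
    rw [h1, h2]
    simp [pow_two]
  · have h1 : iIndepFun (fun i (x : ι → ℝ) => x i) (gaussianPi ι s) :=
      iIndepFun_pi (μ := fun _ : ι => gaussianReal 0 s) (X := fun _ x => x) fun _ => aemeasurable_id
    have h2 := (h1.indepFun hij).integral_fun_mul_eq_mul_integral
      (measurable_pi_apply i).aestronglyMeasurable (measurable_pi_apply j).aestronglyMeasurable
    rw [h2, integral_eval_gaussianPi, zero_mul]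

/-- With `c` the vector of partial derivatives at a fixed point, this is what turns the derivative
in a random Gaussian direction into the squared gradient. -/
lemma integral_norm_sq_sum_gaussianPi (s : NNReal) (c : ι → ℂ) :
    ∫ x, ‖∑ i, (x i : ℂ) * c i‖ ^ 2 ∂gaussianPi ι s = s * ∑ i, ‖c i‖ ^ 2 := by
  have h1 : ∀ x : ι → ℝ, ‖∑ i, (x i : ℂ) * c i‖ ^ 2
      = ∑ i, ∑ j, x i * x j * (c i * (starRingEnd ℂ) (c j)).re := fun x => by
    have h2 : ((‖∑ i, (x i : ℂ) * c i‖ ^ 2 : ℝ) : ℂ)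
        = ∑ i, ∑ j, ((x i * x j : ℝ) : ℂ) * (c i * (starRingEnd ℂ) (c j)) := by
      rw [Complex.ofReal_pow, ← Complex.mul_conj', map_sum, Finset.sum_mul_sum]
      refine Finset.sum_congr rfl fun i _ => Finset.sum_congr rfl fun j _ => ?_
      rw [map_mul, Complex.conj_ofReal]
      push_cast
      ring
    have h3 := congrArg Complex.re h2
    rw [Complex.ofReal_re] at h3
    rw [h3]
    simp only [Complex.re_sum, Complex.re_ofReal_mul]
  have h4 : ∀ i j, Integrable (fun x : ι → ℝ => x i * x j * (c i * (starRingEnd ℂ) (c j)).re)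
      (gaussianPi ι s) := fun i j =>
    ((memLp_eval_gaussianPi s i).integrable_mul (memLp_eval_gaussianPi s j)).mul_const _
  simp only [h1]
  rw [integral_finsetSum _ fun i _ => integrable_finsetSum _ fun j _ => h4 i j, Finset.mul_sum]
  refine Finset.sum_congr rfl fun i _ => ?_
  rw [integral_finsetSum _ fun j _ => h4 i j]
  simp only [integral_mul_const, integral_eval_mul_eval_gaussianPi, ite_mul, zero_mul,
    Finset.sum_ite_eq, Finset.mem_univ, if_true, Complex.mul_conj, Complex.ofReal_re,
    Complex.normSq_eq_norm_sq]

lemma clm_apply_eq_sum_single {F : Type*} [NormedAddCommGroup F] [NormedSpace ℝ F]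
    (L : (ι → ℝ) →L[ℝ] F) (v : ι → ℝ) : L v = ∑ i, v i • L (Pi.single i 1) := by
  conv_lhs => rw [pi_eq_sum_univ' v]
  simp

/-- A crude bound, with a dimensional factor that is harmless: it only supplies integrability and
domination and never enters a final constant. -/
lemma norm_fderiv_le_of_gradNormSq_le {f : (ι → ℝ) → ℂ} {x : ι → ℝ} {G : ℝ}
    (hG : gradNormSq f x ≤ G) : ‖fderiv ℝ f x‖ ≤ Fintype.card ι * √G := by
  refine ContinuousLinearMap.opNorm_le_bound _ (by positivity) fun v => ?_
  rw [clm_apply_eq_sum_single]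
  calc ‖∑ i, v i • fderiv ℝ f x (Pi.single i 1)‖ ≤ ∑ _i : ι, √G * ‖v‖ := by
        refine norm_sum_le_of_le _ fun i _ => ?_
        rw [norm_smul, mul_comm]
        refine mul_le_mul (Real.le_sqrt_of_sq_le (le_trans ?_ hG)) (norm_le_pi_norm v i)
          (norm_nonneg _) (Real.sqrt_nonneg _)
        exact Finset.single_le_sum (f := fun i => ‖fderiv ℝ f x (Pi.single i 1)‖ ^ 2)
          (fun _ _ => by positivity) (Finset.mem_univ i)
    _ = _ := by simp; ring

lemma sq_norm_intervalIntegral_le {g : ℝ → ℂ} (hg : Continuous g) {b : ℝ} (hb : 0 < b) :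
    ‖∫ θ in (0 : ℝ)..b, g θ‖ ^ 2 ≤ b * ∫ θ in (0 : ℝ)..b, ‖g θ‖ ^ 2 := by
  set m := (∫ θ in (0 : ℝ)..b, ‖g θ‖) with hm
  have h1 : ‖∫ θ in (0 : ℝ)..b, g θ‖ ≤ m := intervalIntegral.norm_integral_le_integral_norm hb.le
  -- Cauchy–Schwarz by integrating the tangent-line inequality `t² ≥ 2 t₀ t - t₀²` at the mean value
  -- `t₀ = m / b`.
  have h2 : ∫ θ in (0 : ℝ)..b, (2 * (m / b) * ‖g θ‖ - (m / b) ^ 2)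
      ≤ ∫ θ in (0 : ℝ)..b, ‖g θ‖ ^ 2 := by
    refine intervalIntegral.integral_mono_on hb.le ?_ ?_ fun θ _ => ?_
    · exact Continuous.intervalIntegrable (by fun_prop) _ _
    · exact Continuous.intervalIntegrable (by fun_prop) _ _
    · nlinarith [sq_nonneg (‖g θ‖ - m / b)]
  rw [intervalIntegral.integral_sub (Continuous.intervalIntegrable (by fun_prop) _ _)
    (Continuous.intervalIntegrable (by fun_prop) _ _), intervalIntegral.integral_const_mul,
    intervalIntegral.integral_const, ← hm, smul_eq_mul, sub_zero] at h2
  calc _ ≤ m ^ 2 := pow_le_pow_left₀ (norm_nonneg _) h1 2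
    _ = b * (2 * (m / b) * m - b * (m / b) ^ 2) := by field_simp; ring
    _ ≤ _ := by gcongr

/-- A **Gaussian Poincaré inequality** for functions with bounded gradient. -/
lemma variance_gaussianPi_le (s : NNReal) {f : (ι → ℝ) → ℂ} (hf : ContDiff ℝ 1 f) {C G : ℝ}
    (hC : ∀ x, ‖f x‖ ≤ C) (hG : ∀ x, gradNormSq f x ≤ G) :
    ∫ x, ‖f x - ∫ y, f y ∂gaussianPi ι s‖ ^ 2 ∂gaussianPi ι s ≤ Real.pi ^ 2 / 8 * s * G := by
  set γ := gaussianPi ι s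
  have hγ : IsGaussian γ := isGaussian_gaussianPi s
  have hmean : ∫ x, id x ∂γ = 0 := by
    ext i
    have h := (ContinuousLinearMap.proj (R := ℝ) (φ := fun _ : ι => ℝ) i).integral_comp_comm
      hγ.integrable_id
    exact h.symm.trans (integral_eval_gaussianPi s i)
  set V := ∫ x, ‖f x - ∫ y, f y ∂γ‖ ^ 2 ∂γ
  have hfc := hf.continuous
  have hdfc : Continuous (fderiv ℝ f) := hf.continuous_fderiv one_ne_zero
  have hK := fun x => norm_fderiv_le_of_gradNormSq_le (hG x)
  set K := Fintype.card ι * √G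
  have hK0 : 0 ≤ K := by positivity
  have hf1 : Integrable f γ := integrable_of_continuous_of_bound hfc hC
  have hf2 : Integrable (fun x => ‖f x‖ ^ 2) γ :=
    integrable_of_continuous_of_bound (C := C ^ 2) (by fun_prop) fun x => by
      rw [Real.norm_of_nonneg (by positivity)]
      exact pow_le_pow_left₀ (norm_nonneg _) (hC x) 2
  -- Symmetrization: two independent copies differ, in mean square, by twice the variance.
  have h1 : ∫ z : (ι → ℝ) × (ι → ℝ), ‖f z.2 - f z.1‖ ^ 2 ∂γ.prod γ = 2 * V := by
    rw [integral_prod _ (integrable_of_continuous_of_bound (C := (C + C) ^ 2) (by fun_prop)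
      fun z => ?_)]
    · have h0 : ∀ x, ∫ y, ‖f y - f x‖ ^ 2 ∂γ = V + ‖∫ y, f y ∂γ - f x‖ ^ 2 := fun x =>
        integral_norm_sub_sq hf1 hf2 (f x)
      simp only [h0]
      have h2 : Integrable (fun x => ‖∫ y, f y ∂γ - f x‖ ^ 2) γ :=
        integrable_of_continuous_of_bound (C := (‖∫ y, f y ∂γ‖ + C) ^ 2) (by fun_prop) fun x => by
          rw [Real.norm_of_nonneg (by positivity)]
          exact pow_le_pow_left₀ (norm_nonneg _) ((norm_sub_le _ _).trans (by gcongr; exact hC x)) 2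
      rw [integral_add (integrable_const _) h2]
      have h2' : ∀ x, ‖∫ y, f y ∂γ - f x‖ = ‖f x - ∫ y, f y ∂γ‖ := fun x => norm_sub_rev _ _
      simp only [h2', integral_const, probReal_univ, one_smul]
      change V + V = 2 * V
      ring
    · rw [Real.norm_of_nonneg (by positivity)]
      exact pow_le_pow_left₀ (norm_nonneg _)
        ((norm_sub_le _ _).trans (add_le_add (hC _) (hC _))) 2
  let ψ : (ι → ℝ) × (ι → ℝ) → ℂ := fun z => fderiv ℝ f z.1 z.2
  have hψc : Continuous ψ := by
    exact (hdfc.comp continuous_fst).clm_apply continuous_snd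
  let rot : ℝ → (ι → ℝ) × (ι → ℝ) → (ι → ℝ) × (ι → ℝ) :=
    fun θ z => ContinuousLinearMap.rotation θ z
  have hrot : Continuous fun w : ((ι → ℝ) × (ι → ℝ)) × ℝ => rot w.2 w.1 := by
    simp only [rot, ContinuousLinearMap.rotation_apply]
    fun_prop
  have hψrot : Continuous fun w : ((ι → ℝ) × (ι → ℝ)) × ℝ => ψ (rot w.2 w.1) := hψc.comp hrot
  -- The copies are joined by the quarter circle `cos θ · z₁ + sin θ · z₂`, whose velocity is the
  -- second component of the rotated pair. Hence the integrand is one function `ψ` composed with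
  -- rotations.
  have h3 : ∀ z : (ι → ℝ) × (ι → ℝ),
      f z.2 - f z.1 = ∫ θ in (0 : ℝ)..(Real.pi / 2), ψ (rot θ z) := fun z => by
    have h4 : ∀ θ : ℝ, HasDerivAt (fun θ => f (rot θ z).1) (ψ (rot θ z)) θ := fun θ => by
      have h5 : HasDerivAt (fun θ => (rot θ z).1) (rot θ z).2 θ := by
        simp only [rot, ContinuousLinearMap.rotation_apply]
        exact ((Real.hasDerivAt_cos θ).smul_const z.1).add ((Real.hasDerivAt_sin θ).smul_const z.2)
      exact ((hf.differentiable one_ne_zero _).hasFDerivAt).comp_hasDerivAt θ h5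
    rw [intervalIntegral.integral_eq_sub_of_hasDerivAt (fun θ _ => h4 θ)
      (Continuous.intervalIntegrable
        (hψrot.comp (by fun_prop : Continuous fun θ : ℝ => (z, θ))) _ _)]
    simp [rot, ContinuousLinearMap.rotation_apply]
  have hpi : (0 : ℝ) < Real.pi / 2 := by positivity
  have h7 : Integrable (fun x : ι → ℝ => ‖x‖ ^ 2) γ :=
    hγ.memLp_two_id.integrable_norm_pow two_ne_zero
  have hint : Integrable (fun w : ((ι → ℝ) × (ι → ℝ)) × ℝ => ‖ψ (rot w.2 w.1)‖ ^ 2)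
      ((γ.prod γ).prod (volume.restrict (Set.Ioc 0 (Real.pi / 2)))) := by
    have h6 : Integrable (fun z : (ι → ℝ) × (ι → ℝ) => K ^ 2 * (2 * ‖z.1‖ ^ 2 + 2 * ‖z.2‖ ^ 2))
        (γ.prod γ) := by
      exact (((h7.comp_fst γ).const_mul 2).add ((h7.comp_snd γ).const_mul 2)).const_mul _
    refine (h6.comp_fst (volume.restrict (Set.Ioc 0 (Real.pi / 2)))).mono'
      (hψrot.norm.pow 2).aestronglyMeasurable (ae_of_all _ fun w => ?_)
    rw [Real.norm_of_nonneg (by positivity)]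
    have h8 : ‖ψ (rot w.2 w.1)‖ ≤ K * ‖(rot w.2 w.1).2‖ :=
      (ContinuousLinearMap.le_opNorm _ _).trans (by gcongr; exact hK _)
    have h9 : ‖(rot w.2 w.1).2‖ ≤ ‖w.1.1‖ + ‖w.1.2‖ := by
      simp only [rot, ContinuousLinearMap.rotation_apply]
      refine (norm_add_le _ _).trans (add_le_add ?_ ?_)
      · rw [norm_smul, norm_neg]
        exact mul_le_of_le_one_left (norm_nonneg _) (Real.abs_sin_le_one _)
      · rw [norm_smul]
        exact mul_le_of_le_one_left (norm_nonneg _) (Real.abs_cos_le_one _)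
    calc _ ≤ (K * (‖w.1.1‖ + ‖w.1.2‖)) ^ 2 :=
          pow_le_pow_left₀ (norm_nonneg _) (h8.trans (by gcongr)) 2
      _ = K ^ 2 * (‖w.1.1‖ + ‖w.1.2‖) ^ 2 := by ring
      _ ≤ _ := by
          gcongr
          nlinarith [sq_nonneg (‖w.1.1‖ - ‖w.1.2‖)]
  -- By rotation invariance the integral does not depend on `θ`. At `θ = 0` position and velocity
  -- are independent, and for a fixed position `ψ` is a linear form in a Gaussian vector.
  have h10 : ∀ θ, ∫ z, ‖ψ (rot θ z)‖ ^ 2 ∂γ.prod γ ≤ s * G := fun θ => by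
    have h11 : ∫ z, ‖ψ (rot θ z)‖ ^ 2 ∂γ.prod γ = ∫ z, ‖ψ z‖ ^ 2 ∂γ.prod γ := by
      conv_rhs => rw [← hγ.map_rotation_eq_self hmean θ]
      rw [integral_map (by fun_prop) (Continuous.aestronglyMeasurable (by fun_prop))]
    have h12 : Integrable (fun z => ‖ψ z‖ ^ 2) (γ.prod γ) := by
      refine ((h7.comp_snd γ).const_mul (K ^ 2)).mono' (hψc.norm.pow 2).aestronglyMeasurable
        (ae_of_all _ fun z => ?_)
      rw [Real.norm_of_nonneg (by positivity), ← mul_pow]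
      exact pow_le_pow_left₀ (norm_nonneg _)
        ((ContinuousLinearMap.le_opNorm _ _).trans (by gcongr; exact hK _)) 2
    rw [h11, integral_prod _ h12]
    have h13 : ∀ x, ∫ y, ‖ψ (x, y)‖ ^ 2 ∂γ ≤ s * G := fun x => by
      have h14 : ∀ y, ψ (x, y) = ∑ i, (y i : ℂ) * fderiv ℝ f x (Pi.single i 1) := fun y => by
        simp only [ψ, clm_apply_eq_sum_single (fderiv ℝ f x) y, Complex.real_smul]
      simp only [h14]
      rw [integral_norm_sq_sum_gaussianPi]
      exact mul_le_mul_of_nonneg_left (hG x) s.2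
    calc _ ≤ ∫ _, s * G ∂γ := integral_mono h12.integral_prod_left (integrable_const _) h13
      _ = _ := by simp
  -- One factor `π/2` is the length of the path, from Cauchy–Schwarz in `θ`; the other comes from
  -- integrating the uniform bound over `θ`. Halving gives `π²/8`.
  have h15 : 2 * V ≤ Real.pi / 2 * (Real.pi / 2 * (s * G)) := by
    rw [← h1]
    calc _ ≤ ∫ z, (Real.pi / 2 * ∫ θ in Set.Ioc 0 (Real.pi / 2), ‖ψ (rot θ z)‖ ^ 2) ∂γ.prod γ := by
          refine integral_mono_of_nonneg (ae_of_all _ fun z => by positivity)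
            (hint.integral_prod_left.const_mul _) (ae_of_all _ fun z => ?_)
          simp only
          rw [h3, ← intervalIntegral.integral_of_le hpi.le]
          exact sq_norm_intervalIntegral_le
            (hψrot.comp (by fun_prop : Continuous fun θ : ℝ => (z, θ))) hpi
      _ = Real.pi / 2 * ∫ θ in Set.Ioc 0 (Real.pi / 2), (∫ z, ‖ψ (rot θ z)‖ ^ 2 ∂γ.prod γ) := by
          rw [integral_const_mul, integral_integral_swap (f := fun z θ => ‖ψ (rot θ z)‖ ^ 2) hint]
      _ ≤ Real.pi / 2 * ∫ _ in Set.Ioc 0 (Real.pi / 2), s * G := by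
          exact mul_le_mul_of_nonneg_left
            (integral_mono hint.integral_prod_right (integrable_const _) h10) hpi.le
      _ = _ := by simp [hpi.le]
  linarith

variable {κ : Type*} [Fintype κ] [DecidableEq κ]

lemma PoincareInequality.variance_le {ν : Measure (κ → ℝ)} [IsProbabilityMeasure ν] {c : ℝ}
    (hν : PoincareInequality ν c) (hc : 0 ≤ c) {f : (κ → ℝ) → ℂ} (hf : ContDiff ℝ 1 f) {C G : ℝ}
    (hC : ∀ x, ‖f x‖ ≤ C) (hG : ∀ x, gradNormSq f x ≤ G) :
    ∫ x, ‖f x - ∫ y, f y ∂ν‖ ^ 2 ∂ν ≤ c * G := by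
  have hG0 : 0 ≤ G := le_trans (by unfold gradNormSq; positivity) (hG 0)
  have h1 := hν f hf (MemLp.of_bound hf.continuous.aestronglyMeasurable C (ae_of_all _ hC))
  have h2 : ∫⁻ x, ENNReal.ofReal (gradNormSq f x) ∂ν ≤ ENNReal.ofReal G :=
    (lintegral_mono fun x => ENNReal.ofReal_le_ofReal (hG x)).trans (by simp)
  have hfc := hf.continuous
  rw [integral_eq_lintegral_of_nonneg_ae (ae_of_all _ fun x => by positivity)
    (Continuous.aestronglyMeasurable (by fun_prop))]
  refine ENNReal.toReal_le_of_le_ofReal (by positivity) (h1.trans ?_)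
  rw [ENNReal.ofReal_mul hc]
  gcongr

/-- Averaging over `x` commutes with differentiation in `y` and, by Jensen, does not increase the
bound on the gradient. Thus the Poincaré inequality of `ν` applies to the partial mean. -/
lemma gradNormSq_integral_le {γ : Measure (ι → ℝ)} [IsProbabilityMeasure γ]
    {F : (ι → ℝ) × (κ → ℝ) → ℂ} (hF : ContDiff ℝ 1 F)
    {C G : ℝ} (hC : ∀ z, ‖F z‖ ≤ C) (hG : ∀ x y, gradNormSq (fun y => F (x, y)) y ≤ G) :
    ContDiff ℝ 1 (fun y => ∫ x, F (x, y) ∂γ) ∧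
      ∀ y, gradNormSq (fun y => ∫ x, F (x, y) ∂γ) y ≤ G := by
  have hFc := hF.continuous
  have hdF : ∀ x y, HasFDerivAt (fun y => F (x, y))
      ((fderiv ℝ F (x, y)).comp (ContinuousLinearMap.inr ℝ (ι → ℝ) (κ → ℝ))) y := fun x y =>
    ((hF.differentiable one_ne_zero (x, y)).hasFDerivAt).comp y (hasFDerivAt_prodMk_right x y)
  set D : (κ → ℝ) → (ι → ℝ) → ((κ → ℝ) →L[ℝ] ℂ) := fun y x =>
    (fderiv ℝ F (x, y)).comp (ContinuousLinearMap.inr ℝ (ι → ℝ) (κ → ℝ))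
  have hDc : Continuous fun z : (ι → ℝ) × (κ → ℝ) => D z.2 z.1 := by
    have := hF.continuous_fderiv one_ne_zero
    exact this.clm_comp continuous_const
  have hDb : ∀ y x, ‖D y x‖ ≤ Fintype.card κ * √G := fun y x => by
    have := norm_fderiv_le_of_gradNormSq_le (hG x y)
    rwa [(hdF x y).fderiv] at this
  have hDi : ∀ y, Integrable (D y) γ := fun y => integrable_of_continuous_of_bound
    (hDc.comp (by fun_prop : Continuous fun x : ι → ℝ => (x, y))) (hDb y)
  have hder : ∀ y, HasFDerivAt (fun y => ∫ x, F (x, y) ∂γ) (∫ x, D y x ∂γ) y := fun y =>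
    hasFDerivAt_integral_of_dominated_of_fderiv_le (F := fun y x => F (x, y)) (F' := D)
      (bound := fun _ => Fintype.card κ * √G) Filter.univ_mem
      (Filter.Eventually.of_forall fun y => Continuous.aestronglyMeasurable (by fun_prop))
      (integrable_of_continuous_of_bound (by fun_prop) fun x => hC (x, y))
      (hDi y).aestronglyMeasurable
      (ae_of_all _ fun x y _ => hDb y x) (integrable_const _)
      (ae_of_all _ fun x y _ => hdF x y)
  refine ⟨contDiff_one_iff_hasFDerivAt.mpr ⟨_, ?_, hder⟩, fun y => ?_⟩
  · exact continuous_of_dominated (fun y => (hDi y).aestronglyMeasurable)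
      (fun y => ae_of_all _ (hDb y)) (integrable_const _)
      (ae_of_all _ fun x => hDc.comp (by fun_prop : Continuous fun y : κ → ℝ => (x, y)))
  · have h1 : ∀ i, ‖fderiv ℝ (fun y => ∫ x, F (x, y) ∂γ) y (Pi.single i 1)‖ ^ 2
        ≤ ∫ x, ‖D y x (Pi.single i 1)‖ ^ 2 ∂γ := fun i => by
      have hi : Continuous fun x => D y x (Pi.single i 1) :=
        (hDc.comp (by fun_prop : Continuous fun x : ι → ℝ => (x, y))).clm_apply continuous_const
      have hb : ∀ x, ‖D y x (Pi.single i 1)‖ ≤ Fintype.card κ * √G := fun x => by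
        refine (ContinuousLinearMap.le_opNorm _ _).trans ?_
        rw [Pi.norm_single, norm_one, mul_one]
        exact hDb y x
      rw [(hder y).fderiv, ContinuousLinearMap.integral_apply (hDi y)]
      -- Jensen's inequality for the square: the difference of the two sides is a variance.
      have h2 := integral_norm_sub_sq (μ := γ) (integrable_of_continuous_of_bound hi hb)
        (integrable_of_continuous_of_bound (hi.norm.pow 2) fun x => by
          rw [Real.norm_of_nonneg (by positivity)]
          exact pow_le_pow_left₀ (norm_nonneg _) (hb x) 2) 0
      simp only [sub_zero] at h2
      rw [h2]
      exact le_add_of_nonneg_left (integral_nonneg fun _ => by positivity)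
    have hint : ∀ i, Integrable (fun x => ‖D y x (Pi.single i 1)‖ ^ 2) γ := fun i =>
      integrable_of_continuous_of_bound (C := (Fintype.card κ * √G) ^ 2)
        (((hDc.comp (by fun_prop : Continuous fun x : ι → ℝ => (x, y))).clm_apply
          continuous_const).norm.pow 2) fun x => by
          rw [Real.norm_of_nonneg (by positivity)]
          refine pow_le_pow_left₀ (norm_nonneg _)
            ((ContinuousLinearMap.le_opNorm _ _).trans ?_) 2
          rw [Pi.norm_single, norm_one, mul_one]
          exact hDb y x
    calc _ ≤ ∑ i, ∫ x, ‖D y x (Pi.single i 1)‖ ^ 2 ∂γ := Finset.sum_le_sum fun i _ => h1 i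
      _ = ∫ x, ∑ i, ‖D y x (Pi.single i 1)‖ ^ 2 ∂γ := (integral_finsetSum _ fun i _ => hint i).symm
      _ ≤ ∫ _, G ∂γ := by
          refine integral_mono (integrable_finsetSum _ fun i _ => hint i) (integrable_const _)
            fun x => ?_
          have := hG x y
          rwa [gradNormSq, (hdF x y).fderiv] at this
      _ = G := by simp

/-- Tensorization of the Poincaré inequality between a Gaussian law and a law `ν`. -/
lemma PoincareInequality.variance_prod_le {ν : Measure (κ → ℝ)} [IsProbabilityMeasure ν] {c : ℝ}
    (hν : PoincareInequality ν c) (hc : 0 ≤ c) (s : NNReal) {F : (ι → ℝ) × (κ → ℝ) → ℂ}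
    (hF : ContDiff ℝ 1 F) {C G₁ G₂ : ℝ} (hC : ∀ z, ‖F z‖ ≤ C)
    (hG₁ : ∀ x y, gradNormSq (fun x => F (x, y)) x ≤ G₁)
    (hG₂ : ∀ x y, gradNormSq (fun y => F (x, y)) y ≤ G₂) :
    ∫ z, ‖F z - ∫ w, F w ∂(gaussianPi ι s).prod ν‖ ^ 2 ∂(gaussianPi ι s).prod ν
      ≤ Real.pi ^ 2 / 8 * s * G₁ + c * G₂ := by
  set γ := gaussianPi ι s
  have hFc := hF.continuous
  have hFi : Integrable F (γ.prod ν) := integrable_of_continuous_of_bound hFc hC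
  obtain ⟨hH, hHG⟩ := gradNormSq_integral_le (γ := γ) hF hC hG₂
  set H : (κ → ℝ) → ℂ := fun y => ∫ x, F (x, y) ∂γ
  have hHb : ∀ y, ‖H y‖ ≤ C := fun y => by
    refine (norm_integral_le_of_norm_le_const (ae_of_all _ fun x => hC (x, y))).trans ?_
    simp
  have hm : ∫ w, F w ∂γ.prod ν = ∫ y, H y ∂ν := integral_prod_symm _ hFi
  set m := ∫ y, H y ∂ν
  have hsq : ∀ w : ℂ, ‖w‖ ≤ C → ‖‖w - m‖ ^ 2‖ ≤ (C + ‖m‖) ^ 2 := fun w hw => by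
    rw [Real.norm_of_nonneg (by positivity)]
    exact pow_le_pow_left₀ (norm_nonneg _) ((norm_sub_le _ _).trans (by gcongr)) 2
  have h1 : Integrable (fun z => ‖F z - m‖ ^ 2) (γ.prod ν) :=
    integrable_of_continuous_of_bound (by fun_prop) fun z => hsq _ (hC z)
  have hHc := hH.continuous
  have h2 : Integrable (fun y => ‖H y - m‖ ^ 2) ν :=
    integrable_of_continuous_of_bound (by fun_prop) fun y => hsq _ (hHb y)
  rw [hm, integral_prod_symm _ h1]
  -- Law of total variance: given `y`, the Gaussian inequality controls the fluctuation around the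
  -- partial mean `H y`; the fluctuation of `H` itself is left to `ν`.
  have h3 : ∀ y, ∫ x, ‖F (x, y) - m‖ ^ 2 ∂γ ≤ Real.pi ^ 2 / 8 * s * G₁ + ‖H y - m‖ ^ 2 :=
    fun y => by
      rw [integral_norm_sub_sq (f := fun x => F (x, y))
        (integrable_of_continuous_of_bound (by fun_prop) fun x => hC (x, y))
        (integrable_of_continuous_of_bound (C := C ^ 2) (by fun_prop) fun x => by
          rw [Real.norm_of_nonneg (by positivity)]
          exact pow_le_pow_left₀ (norm_nonneg _) (hC _) 2)]
      gcongr
      exact variance_gaussianPi_le s (hF.comp (by fun_prop)) (fun x => hC (x, y))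
        fun x => hG₁ x y
  calc _ ≤ ∫ y, (Real.pi ^ 2 / 8 * s * G₁ + ‖H y - m‖ ^ 2) ∂ν :=
        integral_mono h1.integral_prod_right ((integrable_const _).add h2) h3
    _ = Real.pi ^ 2 / 8 * s * G₁ + ∫ y, ‖H y - m‖ ^ 2 ∂ν := by
        rw [integral_add (integrable_const _) h2]
        simp
    _ ≤ _ := by
        gcongr
        exact hν.variance_le hc hH hHb hHG

end Poincare

/-! ### Resolvents along linear families: smoothness and derivatives -/

section ResolventCalculus

variable {V : Type*} [NormedAddCommGroup V] [NormedSpace ℝ V] {k N : ℕ}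

/-- The resolvent `(Λ ⊗ 1 - W(z))⁻¹` along a linear family of block matrices. -/
def resolvent (Λ : Matrix (Fin k) (Fin k) ℂ)
    (W : V →L[ℝ] Matrix (Fin k × Fin N) (Fin k × Fin N) ℂ) (z : V) :
    Matrix (Fin k × Fin N) (Fin k × Fin N) ℂ := (shifted Λ (W z))⁻¹

variable {c : ℝ} {Λ : Matrix (Fin k) (Fin k) ℂ}
  {W : V →L[ℝ] Matrix (Fin k × Fin N) (Fin k × Fin N) ℂ}

lemma isUnit_shifted (hc : 0 < c) (hΛ : ImGE c Λ) {Z : Matrix (Fin k × Fin N) (Fin k × Fin N) ℂ}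
    (hZ : Z.IsHermitian) : IsUnit (shifted Λ Z) :=
  (hΛ.shifted hZ).isUnit hc

lemma norm_resolvent_le (hc : 0 < c) (hΛ : ImGE c Λ) (hW : ∀ z, (W z).IsHermitian) (z : V) :
    ‖resolvent Λ W z‖ ≤ c⁻¹ :=
  (hΛ.shifted (hW z)).norm_inv_le hc

lemma hasFDerivAt_shifted (z : V) : HasFDerivAt (fun z => shifted Λ (W z)) (-W) z := by
  simpa [shifted] using W.hasFDerivAt.const_sub (Λ ⊗ₖ (1 : Matrix (Fin N) (Fin N) ℂ))

lemma contDiff_resolvent (hc : 0 < c) (hΛ : ImGE c Λ) (hW : ∀ z, (W z).IsHermitian) :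
    ContDiff ℝ 1 (resolvent Λ W) := by
  refine contDiff_iff_contDiffAt.mpr fun z => ?_
  have h1 : ContDiffAt ℝ 1 (fun z => shifted Λ (W z)) z := by
    unfold shifted
    exact contDiffAt_const.sub W.contDiff.contDiffAt
  obtain ⟨u, hu⟩ := isUnit_shifted hc hΛ (hW z)
  have h2 := contDiffAt_ringInverse ℝ (n := 1) u
  rw [hu] at h2
  have h3 := h2.comp z h1
  refine h3.congr_of_eventuallyEq (Filter.Eventually.of_forall fun z => ?_)
  simp [resolvent, nonsing_inv_eq_ringInverse]

lemma fderiv_resolvent (hc : 0 < c) (hΛ : ImGE c Λ) (hW : ∀ z, (W z).IsHermitian) (z v : V) :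
    fderiv ℝ (resolvent Λ W) z v = resolvent Λ W z * W v * resolvent Λ W z := by
  obtain ⟨u, hu⟩ := isUnit_shifted hc hΛ (hW z)
  have h1 := hasFDerivAt_ringInverse (𝕜 := ℝ) u
  rw [hu] at h1
  have h2 := h1.comp z (hasFDerivAt_shifted (Λ := Λ) (W := W) z)
  have h3 : resolvent Λ W = Ring.inverse ∘ fun z => shifted Λ (W z) := by
    funext z; simp [resolvent, nonsing_inv_eq_ringInverse]
  have h4 : resolvent Λ W z = ↑u⁻¹ := by
    rw [resolvent, ← hu, coe_units_inv]
  rw [h4, h3, h2.fderiv]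
  simp

lemma fderiv_resolvent_mul_mul_resolvent (hc : 0 < c) (hΛ : ImGE c Λ) (hW : ∀ z, (W z).IsHermitian)
    {Γ : Matrix (Fin k) (Fin k) ℂ} (hΓ : ImGE c Γ)
    {W' : V →L[ℝ] Matrix (Fin k × Fin N) (Fin k × Fin N) ℂ} (hW' : ∀ z, (W' z).IsHermitian)
    (A : Matrix (Fin k × Fin N) (Fin k × Fin N) ℂ) (z w : V) :
    fderiv ℝ (fun z => resolvent Γ W' z * A * resolvent Λ W z) z w
      = resolvent Γ W' z * W' w * (resolvent Γ W' z * A * resolvent Λ W z)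
        + resolvent Γ W' z * A * resolvent Λ W z * W w * resolvent Λ W z := by
  have hR : ContDiff ℝ 1 (resolvent Λ W) := contDiff_resolvent hc hΛ hW
  have hQ : ContDiff ℝ 1 (resolvent Γ W') := contDiff_resolvent hc hΓ hW'
  have h0 := ((hQ.differentiable one_ne_zero z).hasFDerivAt.mul_const' A).mul'
    ((hR.differentiable one_ne_zero z).hasFDerivAt)
  have h2 : fderiv ℝ (fun z => resolvent Γ W' z * A * resolvent Λ W z) z = _ := h0.fderiv
  rw [h2]
  simp only [FunLike.coe_add, Pi.add_apply, FunLike.coe_smul, Pi.smul_apply,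
    fderiv_resolvent hc hΛ hW, fderiv_resolvent hc hΓ hW',
    smul_eq_mul, MulOpposite.smul_eq_mul_unop, MulOpposite.unop_op]
  simp only [mul_assoc]
  rw [add_comm]

/-- The order of the factors matters: with the resolvent of `T` on the left, the derivative of the
product in the Gaussian directions reduces to the term coming from the right factor. -/
lemma resolvent_sub_resolvent (hc : 0 < c) (hΛ : ImGE c Λ) (hW : ∀ z, (W z).IsHermitian) {c' : ℝ}
    (hc' : 0 < c') {Γ : Matrix (Fin k) (Fin k) ℂ} (hΓ : ImGE c' Γ)
    {W' : V →L[ℝ] Matrix (Fin k × Fin N) (Fin k × Fin N) ℂ} (hW' : ∀ z, (W' z).IsHermitian)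
    (z : V) : resolvent Λ W z - resolvent Γ W' z
      = resolvent Γ W' z * (shifted Γ (W' z) - shifted Λ (W z)) * resolvent Λ W z := by
  have h1 := (isUnit_iff_isUnit_det _).mp (isUnit_shifted hc hΛ (hW z))
  have h2 := (isUnit_iff_isUnit_det _).mp (isUnit_shifted hc' hΓ (hW' z))
  rw [resolvent, resolvent, mul_sub, sub_mul, nonsing_inv_mul _ h2, one_mul, mul_assoc,
    mul_nonsing_inv _ h1, mul_one]

end ResolventCalculus

/-! ### Partial trace and matrix entries as continuous linear maps -/

section PartialTrace

variable {k N : ℕ}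

/-- The partial trace as a continuous linear map. -/
def partialTraceCLM (k N : ℕ) :
    Matrix (Fin k × Fin N) (Fin k × Fin N) ℂ →L[ℂ] Matrix (Fin k) (Fin k) ℂ :=
  LinearMap.toContinuousLinearMap
    { toFun := partialTrace
      map_add' := fun A B => by
        ext u v; simp [partialTrace, Finset.sum_add_distrib, mul_add]
      map_smul' := fun c A => by
        ext u v; simp [partialTrace, Finset.mul_sum, mul_left_comm] }

lemma partialTraceCLM_apply (M : Matrix (Fin k × Fin N) (Fin k × Fin N) ℂ) :
    partialTraceCLM k N M = partialTrace M := rfl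

/-- The entries of a matrix as continuous linear maps. -/
def entryCLM {n : Type*} [Fintype n] [DecidableEq n] (u v : n) : Matrix n n ℂ →L[ℂ] ℂ :=
  LinearMap.toContinuousLinearMap (Matrix.entryLinearMap ℂ ℂ u v)

lemma entryCLM_apply {n : Type*} [Fintype n] [DecidableEq n] (u v : n) (M : Matrix n n ℂ) :
    entryCLM u v M = M u v := rfl

/-- An entry of the partial trace as a real continuous linear map. -/
def partialTraceEntry (N : ℕ) (u v : Fin k) : Matrix (Fin k × Fin N) (Fin k × Fin N) ℂ →L[ℝ] ℂ :=
  ((entryCLM u v).comp (partialTraceCLM k N)).restrictScalars ℝ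

lemma partialTraceEntry_apply (u v : Fin k) (M : Matrix (Fin k × Fin N) (Fin k × Fin N) ℂ) :
    partialTraceEntry N u v M = partialTrace M u v := rfl

lemma partialTrace_add (A B : Matrix (Fin k × Fin N) (Fin k × Fin N) ℂ) :
    partialTrace (A + B) = partialTrace A + partialTrace B := (partialTraceCLM k N).map_add A B

end PartialTrace

/-! ### Families with controlled gradients -/

section Gradients

variable {ι : Type*} [Fintype ι] {k N : ℕ}

/-- A family of Hermitian block matrices such that the gradients of the partial traces of
`A * W * B` along the family are controlled by the norms of `A` and `B`. -/
structure IsGradientBounded (D : ι → Matrix (Fin k × Fin N) (Fin k × Fin N) ℂ) (β : ℝ) : Prop where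
  isHermitian : ∀ i, (D i).IsHermitian
  sum_le : ∀ (A B : Matrix (Fin k × Fin N) (Fin k × Fin N) ℂ) (u v : Fin k),
    ∑ i, ‖partialTrace (A * D i * B) u v‖ ^ 2 ≤ k / N * (‖A‖ * ‖B‖) ^ 2 * β

/-- The linear family `x ↦ ∑ᵢ xᵢ Dᵢ`. -/
def linearFamily (D : ι → Matrix (Fin k × Fin N) (Fin k × Fin N) ℂ) :
    (ι → ℝ) →L[ℝ] Matrix (Fin k × Fin N) (Fin k × Fin N) ℂ :=
  ∑ i, (ContinuousLinearMap.proj (R := ℝ) (φ := fun _ : ι => ℝ) i).smulRight (D i)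

lemma linearFamily_apply (D : ι → Matrix (Fin k × Fin N) (Fin k × Fin N) ℂ) (x : ι → ℝ) :
    linearFamily D x = ∑ i, x i • D i := by
  simp [linearFamily]

lemma linearFamily_single [DecidableEq ι] (D : ι → Matrix (Fin k × Fin N) (Fin k × Fin N) ℂ)
    (i : ι) : linearFamily D (Pi.single i 1) = D i := by
  simp [linearFamily_apply, Pi.single_apply]

lemma IsGradientBounded.linearFamily_isHermitian
    {D : ι → Matrix (Fin k × Fin N) (Fin k × Fin N) ℂ} {β : ℝ} (hD : IsGradientBounded D β)
    (x : ι → ℝ) : (linearFamily D x).IsHermitian := by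
  rw [linearFamily_apply, IsHermitian, conjTranspose_sum]
  refine Finset.sum_congr rfl fun i _ => ?_
  rw [conjTranspose_smul, (hD.isHermitian i).eq]
  simp

end Gradients

/-! ### Variance bounds for partial traces of resolvents -/

section TwoFamilies

variable {ι κ : Type*} [Fintype ι] [DecidableEq ι] [Fintype κ] [DecidableEq κ] {k N : ℕ}
  {D : ι → Matrix (Fin k × Fin N) (Fin k × Fin N) ℂ}
  {F : κ → Matrix (Fin k × Fin N) (Fin k × Fin N) ℂ} {α β : ℝ}

/-- The family `(x, y) ↦ ∑ᵢ xᵢ Dᵢ + ∑ᵢ yᵢ Fᵢ`. -/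
def sumFamily (D : ι → Matrix (Fin k × Fin N) (Fin k × Fin N) ℂ)
    (F : κ → Matrix (Fin k × Fin N) (Fin k × Fin N) ℂ) :
    (ι → ℝ) × (κ → ℝ) →L[ℝ] Matrix (Fin k × Fin N) (Fin k × Fin N) ℂ :=
  (linearFamily D).coprod (linearFamily F)

/-- The family `(x, y) ↦ ∑ᵢ yᵢ Fᵢ`. -/
def sndFamily (ι : Type*) [Fintype ι] (F : κ → Matrix (Fin k × Fin N) (Fin k × Fin N) ℂ) :
    (ι → ℝ) × (κ → ℝ) →L[ℝ] Matrix (Fin k × Fin N) (Fin k × Fin N) ℂ :=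
  (linearFamily F).comp (ContinuousLinearMap.snd ℝ (ι → ℝ) (κ → ℝ))

lemma sumFamily_isHermitian (hD : IsGradientBounded D α) (hF : IsGradientBounded F β)
    (z : (ι → ℝ) × (κ → ℝ)) : (sumFamily D F z).IsHermitian :=
  (hD.linearFamily_isHermitian z.1).add (hF.linearFamily_isHermitian z.2)

lemma sndFamily_isHermitian (hF : IsGradientBounded F β)
    (z : (ι → ℝ) × (κ → ℝ)) : (sndFamily ι F z).IsHermitian :=
  hF.linearFamily_isHermitian z.2

lemma fderiv_fst_single {E : Type*} [NormedAddCommGroup E] [NormedSpace ℝ E]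
    {f : (ι → ℝ) × (κ → ℝ) → E} (hf : ContDiff ℝ 1 f) (x : ι → ℝ) (y : κ → ℝ) (i : ι) :
    fderiv ℝ (fun x => f (x, y)) x (Pi.single i 1) = fderiv ℝ f (x, y) (Pi.single i 1, 0) := by
  have h := HasFDerivAt.comp (g := f) (f := fun x => (x, y)) x
    ((hf.differentiable one_ne_zero (x, y)).hasFDerivAt) (hasFDerivAt_prodMk_left x y)
  change fderiv ℝ (f ∘ fun x => (x, y)) x _ = _
  rw [h.fderiv]
  rfl

lemma fderiv_snd_single {E : Type*} [NormedAddCommGroup E] [NormedSpace ℝ E]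
    {f : (ι → ℝ) × (κ → ℝ) → E} (hf : ContDiff ℝ 1 f) (x : ι → ℝ) (y : κ → ℝ) (i : κ) :
    fderiv ℝ (fun y => f (x, y)) y (Pi.single i 1) = fderiv ℝ f (x, y) (0, Pi.single i 1) := by
  have h := HasFDerivAt.comp (g := f) (f := fun y => (x, y)) y
    ((hf.differentiable one_ne_zero (x, y)).hasFDerivAt) (hasFDerivAt_prodMk_right x y)
  change fderiv ℝ (f ∘ fun y => (x, y)) y _ = _
  rw [h.fderiv]
  rfl

variable {c : ℝ} {Λ Γ : Matrix (Fin k) (Fin k) ℂ}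

/-- The derivative is `tr(R Dᵢ R)`, with two resolvents; squaring gives `c⁻⁴`. -/
lemma variance_partialTrace_resolvent_le (hD : IsGradientBounded D α) (hF : IsGradientBounded F β)
    (hα : 0 ≤ α) (hβ : 0 ≤ β)
    (hc : 0 < c) (hΛ : ImGE c Λ) {ν : Measure (κ → ℝ)} [IsProbabilityMeasure ν] {σ : ℝ}
    (hν : PoincareInequality ν σ) (hσ : 0 ≤ σ) (s : NNReal) (u v : Fin k) :
    ∫ z, ‖partialTrace (resolvent Λ (sumFamily D F) z) u v
        - ∫ w, partialTrace (resolvent Λ (sumFamily D F) w) u v ∂(gaussianPi ι s).prod ν‖ ^ 2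
          ∂(gaussianPi ι s).prod ν
      ≤ k / N * c⁻¹ ^ 4 * (Real.pi ^ 2 / 8 * s * α + σ * β) := by
  set R := resolvent Λ (sumFamily D F)
  have hW := sumFamily_isHermitian hD hF
  have hR : ContDiff ℝ 1 R := contDiff_resolvent hc hΛ hW
  have hRb : ∀ z, ‖R z‖ ≤ c⁻¹ := norm_resolvent_le hc hΛ hW
  have hf : ContDiff ℝ 1 fun z => partialTrace (R z) u v :=
    (partialTraceEntry N u v).contDiff.comp hR
  have hd : ∀ z w, fderiv ℝ (fun z => partialTrace (R z) u v) z w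
      = partialTrace (R z * sumFamily D F w * R z) u v := fun z w => by
    have h1 := ((partialTraceEntry N u v).hasFDerivAt).comp z
      ((hR.differentiable one_ne_zero z).hasFDerivAt)
    change fderiv ℝ (partialTraceEntry N u v ∘ R) z w = _
    rw [h1.fderiv, ContinuousLinearMap.comp_apply, fderiv_resolvent hc hΛ hW,
      partialTraceEntry_apply]
  have hb : ∀ z, (‖R z‖ * ‖R z‖) ^ 2 ≤ c⁻¹ ^ 4 := fun z => by
    calc _ = ‖R z‖ ^ 4 := by ring
      _ ≤ _ := pow_le_pow_left₀ (norm_nonneg _) (hRb z) 4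
  have h1 := hν.variance_prod_le hσ s (F := fun z => partialTrace (R z) u v)
    (C := ‖partialTraceEntry N u v‖ * c⁻¹)
    (G₁ := k / N * c⁻¹ ^ 4 * α) (G₂ := k / N * c⁻¹ ^ 4 * β) hf
    (fun z => ((partialTraceEntry N u v).le_opNorm _).trans (by gcongr; exact hRb z))
    (fun x y => by
      simp only [gradNormSq, fderiv_fst_single hf, hd, sumFamily, ContinuousLinearMap.coprod_apply,
        map_zero, add_zero, linearFamily_single]
      refine (hD.sum_le _ _ u v).trans ?_
      gcongr
      exact hb _)
    (fun x y => by
      simp only [gradNormSq, fderiv_snd_single hf, hd, sumFamily, ContinuousLinearMap.coprod_apply,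
        map_zero, zero_add, linearFamily_single]
      refine (hF.sum_le _ _ u v).trans ?_
      gcongr
      exact hb _)
  refine h1.trans (le_of_eq (by ring))

/-- Each derivative contains three resolvents, hence `c⁻⁶` after squaring. The variables `x` enter
only through `R`, while `y` enters through both `Q` and `R`; this accounts for the extra factor `4`
in front of `σ β`. -/
lemma variance_partialTrace_resolvent_mul_le (hD : IsGradientBounded D α)
    (hF : IsGradientBounded F β) (hα : 0 ≤ α) (hβ : 0 ≤ β)
    (hc : 0 < c) (hΛ : ImGE c Λ) (hΓ : ImGE c Γ) {ν : Measure (κ → ℝ)} [IsProbabilityMeasure ν]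
    {σ : ℝ} (hν : PoincareInequality ν σ) (hσ : 0 ≤ σ) (s : NNReal)
    (A : Matrix (Fin k × Fin N) (Fin k × Fin N) ℂ) (u v : Fin k) :
    ∫ z, ‖partialTrace (resolvent Γ (sndFamily ι F) z * A * resolvent Λ (sumFamily D F) z) u v
        - ∫ w, partialTrace (resolvent Γ (sndFamily ι F) w * A * resolvent Λ (sumFamily D F) w) u v
          ∂(gaussianPi ι s).prod ν‖ ^ 2
          ∂(gaussianPi ι s).prod ν
      ≤ k / N * (c⁻¹ ^ 6 * ‖A‖ ^ 2) * (Real.pi ^ 2 / 8 * s * α + 4 * σ * β) := by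
  set R := resolvent Λ (sumFamily D F)
  set Q := resolvent Γ (sndFamily ι F)
  have hW := sumFamily_isHermitian hD hF
  have hW' := sndFamily_isHermitian (ι := ι) hF
  have hR : ContDiff ℝ 1 R := contDiff_resolvent hc hΛ hW
  have hRb : ∀ z, ‖R z‖ ≤ c⁻¹ := norm_resolvent_le hc hΛ hW
  have hQ : ContDiff ℝ 1 Q := contDiff_resolvent hc hΓ hW'
  have hQb : ∀ z, ‖Q z‖ ≤ c⁻¹ := norm_resolvent_le hc hΓ hW'
  have hL : ContDiff ℝ 1 fun z => Q z * A * R z := (hQ.mul contDiff_const).mul hR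
  have hf : ContDiff ℝ 1 fun z => partialTrace (Q z * A * R z) u v :=
    (partialTraceEntry N u v).contDiff.comp hL
  have hLb : ∀ z, ‖Q z * A * R z‖ ≤ c⁻¹ * ‖A‖ * c⁻¹ := fun z =>
    (norm_mul_le _ _).trans (mul_le_mul ((norm_mul_le _ _).trans (by gcongr; exact hQb z)) (hRb z)
      (norm_nonneg _) (by positivity))
  have hd : ∀ z w, fderiv ℝ (fun z => partialTrace (Q z * A * R z) u v) z w
      = partialTrace (Q z * sndFamily ι F w * (Q z * A * R z)) u v
        + partialTrace ((Q z * A * R z) * sumFamily D F w * R z) u v := fun z w => by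
    have h1 := ((partialTraceEntry N u v).hasFDerivAt).comp z
      ((hL.differentiable one_ne_zero z).hasFDerivAt)
    have h2 : fderiv ℝ (partialTraceEntry N u v ∘ fun z => Q z * A * R z) z = _ := h1.fderiv
    change fderiv ℝ (partialTraceEntry N u v ∘ fun z => Q z * A * R z) z w = _
    rw [h2, ContinuousLinearMap.comp_apply, partialTraceEntry_apply, ← Matrix.add_apply,
      ← partialTrace_add, fderiv_resolvent_mul_mul_resolvent hc hΛ hW hΓ hW']
  have hb : ∀ z, (‖Q z * A * R z‖ * ‖R z‖) ^ 2 ≤ c⁻¹ ^ 6 * ‖A‖ ^ 2 := fun z => by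
    calc _ ≤ (c⁻¹ * ‖A‖ * c⁻¹ * c⁻¹) ^ 2 := by
          gcongr
          · exact hLb z
          · exact hRb z
      _ = _ := by ring
  have hb' : ∀ z, (‖Q z‖ * ‖Q z * A * R z‖) ^ 2 ≤ c⁻¹ ^ 6 * ‖A‖ ^ 2 := fun z => by
    calc _ ≤ (c⁻¹ * (c⁻¹ * ‖A‖ * c⁻¹)) ^ 2 := by
          gcongr
          · exact hQb z
          · exact hLb z
      _ = _ := by ring
  have h1 := hν.variance_prod_le hσ s (F := fun z => partialTrace (Q z * A * R z) u v)
    (C := ‖partialTraceEntry N u v‖ * (c⁻¹ * ‖A‖ * c⁻¹))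
    (G₁ := k / N * (c⁻¹ ^ 6 * ‖A‖ ^ 2) * α) (G₂ := 4 * (k / N * (c⁻¹ ^ 6 * ‖A‖ ^ 2) * β)) hf
    (fun z => ((partialTraceEntry N u v).le_opNorm _).trans (by gcongr; exact hLb z))
    (fun x y => by
      simp only [gradNormSq, fderiv_fst_single hf, hd, sumFamily, sndFamily,
        ContinuousLinearMap.coprod_apply, ContinuousLinearMap.comp_apply,
        ContinuousLinearMap.coe_snd',
        map_zero, add_zero, linearFamily_single, mul_zero, zero_mul]
      have h0 : partialTrace (0 : Matrix (Fin k × Fin N) (Fin k × Fin N) ℂ) = 0 :=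
        (partialTraceCLM k N).map_zero
      simp only [h0, Matrix.zero_apply, zero_add]
      refine (hD.sum_le _ _ u v).trans ?_
      gcongr
      exact hb _)
    (fun x y => by
      simp only [gradNormSq, fderiv_snd_single hf, hd, sumFamily, sndFamily,
        ContinuousLinearMap.coprod_apply, ContinuousLinearMap.comp_apply,
        ContinuousLinearMap.coe_snd',
        map_zero, zero_add, linearFamily_single]
      -- Two terms from the product rule, each with coefficient `2` and the same bound: together the
      -- factor `4` of `G₂`.
      have h2 : ∀ p q : ℂ, ‖p + q‖ ^ 2 ≤ 2 * ‖p‖ ^ 2 + 2 * ‖q‖ ^ 2 := fun p q => by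
        nlinarith [norm_add_le p q, norm_nonneg (p + q), sq_nonneg (‖p‖ - ‖q‖)]
      refine (Finset.sum_le_sum fun i _ => h2 _ _).trans ?_
      rw [Finset.sum_add_distrib, ← Finset.mul_sum, ← Finset.mul_sum]
      have h3 := hF.sum_le (Q (x, y)) (Q (x, y) * A * R (x, y)) u v
      have h4 := hF.sum_le (Q (x, y) * A * R (x, y)) (R (x, y)) u v
      have h5 : k / N * (‖Q (x, y)‖ * ‖Q (x, y) * A * R (x, y)‖) ^ 2 * β
          ≤ k / N * (c⁻¹ ^ 6 * ‖A‖ ^ 2) * β := by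
        gcongr
        exact hb' _
      have h6 : k / N * (‖Q (x, y) * A * R (x, y)‖ * ‖R (x, y)‖) ^ 2 * β
          ≤ k / N * (c⁻¹ ^ 6 * ‖A‖ ^ 2) * β := by
        gcongr
        exact hb _
      linarith)
  refine h1.trans (le_of_eq (by ring))

end TwoFamilies

/-! ### The map `𝓡ₛ` and its expansion over matrix units -/

section LinearMaps

variable {k : ℕ}

/-- The map `𝓡ₛ` as a continuous linear map. -/
def covCLM {p : ℕ} (a : Fin p → Matrix (Fin k) (Fin k) ℂ) :
    Matrix (Fin k) (Fin k) ℂ →L[ℂ] Matrix (Fin k) (Fin k) ℂ :=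
  LinearMap.toContinuousLinearMap
    { toFun := covMap a
      map_add' := fun A B => by simp [covMap, mul_add, add_mul, Finset.sum_add_distrib]
      map_smul' := fun c A => by simp [covMap, Finset.smul_sum] }

lemma covCLM_apply {p : ℕ} (a : Fin p → Matrix (Fin k) (Fin k) ℂ) (M : Matrix (Fin k) (Fin k) ℂ) :
    covCLM a M = covMap a M := rfl

/-- The map `M ↦ M ⊗ 1_N` as a continuous linear map. -/
def kroneckerOneCLM (k N : ℕ) :
    Matrix (Fin k) (Fin k) ℂ →L[ℂ] Matrix (Fin k × Fin N) (Fin k × Fin N) ℂ :=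
  LinearMap.toContinuousLinearMap
    { toFun := fun M => M ⊗ₖ (1 : Matrix (Fin N) (Fin N) ℂ)
      map_add' := fun A B => add_kronecker A B 1
      map_smul' := fun c A => smul_kronecker c A 1 }

lemma kroneckerOneCLM_apply (N : ℕ) (M : Matrix (Fin k) (Fin k) ℂ) :
    kroneckerOneCLM k N M = M ⊗ₖ (1 : Matrix (Fin N) (Fin N) ℂ) := rfl

lemma norm_covMap_single_le {p : ℕ} (a : Fin p → Matrix (Fin k) (Fin k) ℂ) (u v : Fin k) :
    ‖covMap a (single u v 1)‖ ≤ ∑ j, ‖a j‖ ^ 2 := by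
  have h1 : ‖(single u v 1 : Matrix (Fin k) (Fin k) ℂ)‖ ≤ 1 := by
    have h := norm_sq_le_frobSq (single u v 1 : Matrix (Fin k) (Fin k) ℂ)
    have h2 : frobSq (single u v 1 : Matrix (Fin k) (Fin k) ℂ) = 1 := by
      simp only [frobSq, single_apply]
      rw [Finset.sum_eq_single u, Finset.sum_eq_single v]
      all_goals simp +contextual [eq_comm]
    rw [h2] at h
    exact (sq_le_one_iff₀ (norm_nonneg _)).mp h
  refine norm_sum_le_of_le _ fun j _ => ?_
  calc _ ≤ ‖a j‖ * 1 * ‖a j‖ :=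
        (norm_mul_le _ _).trans (by gcongr; exact (norm_mul_le _ _).trans (by gcongr))
    _ = _ := by ring

/-- Separates the scalar random entries of `M` from deterministic matrices, so that the error
becomes a sum of scalar covariances. -/
lemma covMap_eq_sum {p : ℕ} (a : Fin p → Matrix (Fin k) (Fin k) ℂ) (M : Matrix (Fin k) (Fin k) ℂ) :
    covMap a M = ∑ u, ∑ v, M u v • covMap a (single u v 1) := by
  conv_lhs => rw [matrix_eq_sum_single M, ← covCLM_apply]
  simp only [map_sum]
  refine Finset.sum_congr rfl fun u _ => Finset.sum_congr rfl fun v _ => ?_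
  rw [← covCLM_apply, ← map_smul, smul_single, smul_eq_mul, mul_one]

end LinearMaps

/-! ### Cauchy–Schwarz for complex integrals -/

section CauchySchwarz

lemma norm_integral_mul_sq_le {α : Type*} [MeasurableSpace α] {μ : Measure α} {f g : α → ℂ}
    (hf : MemLp f 2 μ) (hg : MemLp g 2 μ) :
    ‖∫ x, f x * g x ∂μ‖ ^ 2 ≤ (∫ x, ‖f x‖ ^ 2 ∂μ) * ∫ x, ‖g x‖ ^ 2 ∂μ := by
  have h1 := integral_mul_le_Lp_mul_Lq_of_nonneg (μ := μ) (f := fun x => ‖f x‖)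
    (g := fun x => ‖g x‖) (p := 2) (q := 2) Real.HolderConjugate.two_two
    (ae_of_all _ fun _ => norm_nonneg _) (ae_of_all _ fun _ => norm_nonneg _)
    (by simpa using hf.norm) (by simpa using hg.norm)
  have h2 : ‖∫ x, f x * g x ∂μ‖ ≤ ∫ x, ‖f x‖ * ‖g x‖ ∂μ := by
    simpa using norm_integral_le_integral_norm (μ := μ) fun x => f x * g x
  simp only [Real.rpow_two, ← Real.sqrt_eq_rpow] at h1
  have h3 : 0 ≤ ∫ x, ‖f x‖ ^ 2 ∂μ := integral_nonneg fun _ => by positivity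
  have h4 : 0 ≤ ∫ x, ‖g x‖ ^ 2 ∂μ := integral_nonneg fun _ => by positivity
  calc _ ≤ (√(∫ x, ‖f x‖ ^ 2 ∂μ) * √(∫ x, ‖g x‖ ^ 2 ∂μ)) ^ 2 :=
        pow_le_pow_left₀ (norm_nonneg _) (h2.trans h1) 2
    _ = _ := by rw [mul_pow, Real.sq_sqrt h3, Real.sq_sqrt h4]

end CauchySchwarz

/-! ### The Schwinger–Dyson equation and the estimate of the error -/

section SchwingerDyson

variable {ι κ : Type*} [Fintype ι] [DecidableEq ι] [Fintype κ] [DecidableEq κ] {k N p : ℕ}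
  {D : ι → Matrix (Fin k × Fin N) (Fin k × Fin N) ℂ}
  {F : κ → Matrix (Fin k × Fin N) (Fin k × Fin N) ℂ} {α β : ℝ}
  {a : Fin p → Matrix (Fin k) (Fin k) ℂ} {c : ℝ} {Λ Γ : Matrix (Fin k) (Fin k) ℂ}
  {ν : Measure (κ → ℝ)} [IsProbabilityMeasure ν]

/-- Integrating by parts in each `xᵢ` gives `N⁻¹ ∑ᵢ E[Q Dᵢ R Dᵢ R]`, because `Q` depends on `y`
alone. The contraction `hDa` evaluates the sum over `i`, and its factor `N` cancels the variance. -/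
lemma integral_resolvent_mul_gaussian_mul_resolvent (hN : 1 ≤ N) (hD : IsGradientBounded D α)
    (hF : IsGradientBounded F β)
    (hDa : ∀ B, ∑ i, D i * B * D i
      = (N : ℂ) • (covMap a (partialTrace B) ⊗ₖ (1 : Matrix (Fin N) (Fin N) ℂ)))
    (hc : 0 < c) (hΛ : ImGE c Λ) (hΓ : ImGE c Γ) :
    Integrable (fun z : (ι → ℝ) × (κ → ℝ) => resolvent Γ (sndFamily ι F) z * linearFamily D z.1
      * resolvent Λ (sumFamily D F) z) ((gaussianPi ι (N : NNReal)⁻¹).prod ν) ∧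
    ∫ z, resolvent Γ (sndFamily ι F) z * linearFamily D z.1 * resolvent Λ (sumFamily D F) z
        ∂(gaussianPi ι (N : NNReal)⁻¹).prod ν
      = ∫ z, resolvent Γ (sndFamily ι F) z
          * (covMap a (partialTrace (resolvent Λ (sumFamily D F) z))
            ⊗ₖ (1 : Matrix (Fin N) (Fin N) ℂ))
          * resolvent Λ (sumFamily D F) z ∂(gaussianPi ι (N : NNReal)⁻¹).prod ν := by
  set R := resolvent Λ (sumFamily D F) with hRdef
  set Q := resolvent Γ (sndFamily ι F) with hQdef
  set γ := gaussianPi ι (N : NNReal)⁻¹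
  have hN' : (N : ℂ) ≠ 0 := by exact_mod_cast (by omega : N ≠ 0)
  have hs : (N : NNReal)⁻¹ ≠ 0 := by
    rw [Ne, inv_eq_zero]
    exact_mod_cast (by omega : N ≠ 0)
  have hW := sumFamily_isHermitian hD hF
  have hW' := sndFamily_isHermitian (ι := ι) hF
  have hR : ContDiff ℝ 1 R := contDiff_resolvent hc hΛ hW
  have hRb : ∀ z, ‖R z‖ ≤ c⁻¹ := norm_resolvent_le hc hΛ hW
  have hQ : ContDiff ℝ 1 Q := contDiff_resolvent hc hΓ hW'
  have hQb : ∀ z, ‖Q z‖ ≤ c⁻¹ := norm_resolvent_le hc hΓ hW'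
  have hRc := hR.continuous
  have hQc := hQ.continuous
  have hf : ∀ i, ContDiff ℝ 1 fun z => Q z * D i * R z := fun i =>
    (hQ.mul contDiff_const).mul hR
  have hfb : ∀ i z, ‖Q z * D i * R z‖ ≤ c⁻¹ * ‖D i‖ * c⁻¹ := fun i z =>
    (norm_mul_le _ _).trans (mul_le_mul ((norm_mul_le _ _).trans (by gcongr; exact hQb z)) (hRb z)
      (norm_nonneg _) (by positivity))
  have hfb' : ∀ i z, ‖Q z * D i * R z * D i * R z‖ ≤ c⁻¹ * ‖D i‖ * c⁻¹ * ‖D i‖ * c⁻¹ := fun i z =>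
    (norm_mul_le _ _).trans (mul_le_mul ((norm_mul_le _ _).trans (by gcongr; exact hfb i z)) (hRb z)
      (norm_nonneg _) (by positivity))
  have hi : ∀ i, Integrable (fun z : (ι → ℝ) × (κ → ℝ) => z.1 i • (Q z * D i * R z))
      (γ.prod ν) := fun i =>
    ((integrable_eval_gaussianPi _ i).comp_fst ν).smul_bdd _ (hf i).continuous.aestronglyMeasurable
      (ae_of_all _ (hfb i))
  have hi' : ∀ i, Integrable (fun z : (ι → ℝ) × (κ → ℝ) => Q z * D i * R z * D i * R z)
      (γ.prod ν) := fun i =>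
    integrable_of_continuous_of_bound (by fun_prop) (hfb' i)
  have hsum : ∀ z : (ι → ℝ) × (κ → ℝ),
      Q z * linearFamily D z.1 * R z = ∑ i, z.1 i • (Q z * D i * R z) := fun z => by
    simp [linearFamily_apply, Finset.mul_sum, Finset.sum_mul]
  have hparts : ∀ i, ∫ z : (ι → ℝ) × (κ → ℝ), z.1 i • (Q z * D i * R z) ∂γ.prod ν
      = (N : ℝ)⁻¹ • ∫ z, Q z * D i * R z * D i * R z ∂γ.prod ν := fun i => by
    rw [integral_prod_symm _ (hi i), integral_prod_symm _ (hi' i), ← integral_smul]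
    refine integral_congr_ae (ae_of_all _ fun y => ?_)
    -- The term from differentiating `Q` vanishes, as `sndFamily` kills the direction `(eᵢ, 0)`.
    have hder : ∀ x, fderiv ℝ (fun x => Q (x, y) * D i * R (x, y)) x (Pi.single i 1)
        = Q (x, y) * D i * R (x, y) * D i * R (x, y) := fun x => by
      rw [fderiv_fst_single (f := fun z => Q z * D i * R z) (hf i),
        fderiv_resolvent_mul_mul_resolvent hc hΛ hW hΓ hW']
      simp [sumFamily, sndFamily, linearFamily_single, hRdef, hQdef]
    have h := integral_smul_gaussianPi hs i (f := fun x => Q (x, y) * D i * R (x, y))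
      ((hf i).comp (by fun_prop)) (fun x => hfb i (x, y)) fun x => by
        rw [hder]; exact hfb' i (x, y)
    simp only [hder] at h
    simpa using h
  simp only [hsum]
  refine ⟨integrable_finsetSum _ fun i _ => hi i, ?_⟩
  rw [integral_finsetSum _ fun i _ => hi i]
  simp only [hparts]
  rw [← Finset.smul_sum, ← integral_finsetSum _ fun i _ => hi' i, ← integral_smul]
  refine integral_congr_ae (ae_of_all _ fun z => ?_)
  have h1 : ∑ i, Q z * D i * R z * D i * R z = Q z * (∑ i, D i * R z * D i) * R z := by
    simp only [Finset.mul_sum, Finset.sum_mul, mul_assoc]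
  simp only [h1, hDa, mul_smul_comm, smul_mul_assoc]
  rw [← Complex.coe_smul, smul_smul]
  push_cast
  rw [inv_mul_cancel₀ hN', one_smul]

variable (a Λ D F ν) in
/-- The mean partial trace of the resolvent of the sum. -/
def meanResolvent : Matrix (Fin k) (Fin k) ℂ :=
  ∫ z, partialTrace (resolvent Λ (sumFamily D F) z) ∂(gaussianPi ι (N : NNReal)⁻¹).prod ν

lemma integrable_partialTrace_resolvent {V : Type*} [NormedAddCommGroup V] [NormedSpace ℝ V]
    [MeasurableSpace V] [OpensMeasurableSpace V] [SecondCountableTopology V] {μ : Measure V}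
    [IsFiniteMeasure μ] {W : V →L[ℝ] Matrix (Fin k × Fin N) (Fin k × Fin N) ℂ}
    (hc : 0 < c) (hΛ : ImGE c Λ) (hW : ∀ z, (W z).IsHermitian) :
    Integrable (fun z => partialTrace (resolvent Λ W z)) μ :=
  integrable_of_continuous_of_bound (C := ‖partialTraceCLM k N‖ * c⁻¹)
    ((partialTraceCLM k N).continuous.comp (contDiff_resolvent hc hΛ hW).continuous) fun z =>
      ((partialTraceCLM k N).le_opNorm _).trans (by
        gcongr; exact norm_resolvent_le hc hΛ hW z)

/-- The choice `Γ = Λ - 𝓡ₛ(G)` subtracts exactly the mean of the term produced by integration by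
parts, so the remainder involves only the centered matrix `tr R - G`. -/
lemma meanResolvent_sub_eq (hN : 1 ≤ N) (hD : IsGradientBounded D α)
    (hF : IsGradientBounded F β)
    (hDa : ∀ B, ∑ i, D i * B * D i
      = (N : ℂ) • (covMap a (partialTrace B) ⊗ₖ (1 : Matrix (Fin N) (Fin N) ℂ)))
    (hc : 0 < c) (hΛ : ImGE c Λ) (hΓ : ImGE c Γ)
    (hΓΛ : Γ = Λ - covMap a (meanResolvent D F Λ ν)) :
    Integrable (fun z => partialTrace (resolvent Γ (sndFamily ι F) z
          * (covMap a (partialTrace (resolvent Λ (sumFamily D F) z) - meanResolvent D F Λ ν)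
            ⊗ₖ (1 : Matrix (Fin N) (Fin N) ℂ))
          * resolvent Λ (sumFamily D F) z)) ((gaussianPi ι (N : NNReal)⁻¹).prod ν) ∧
    meanResolvent D F Λ ν
        - ∫ z, partialTrace (resolvent Γ (sndFamily ι F) z) ∂(gaussianPi ι (N : NNReal)⁻¹).prod ν
      = ∫ z, partialTrace (resolvent Γ (sndFamily ι F) z
          * (covMap a (partialTrace (resolvent Λ (sumFamily D F) z) - meanResolvent D F Λ ν)
            ⊗ₖ (1 : Matrix (Fin N) (Fin N) ℂ))
          * resolvent Λ (sumFamily D F) z) ∂(gaussianPi ι (N : NNReal)⁻¹).prod ν := by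
  obtain ⟨hint, hparts⟩ := integral_resolvent_mul_gaussian_mul_resolvent (ν := ν) hN hD hF hDa hc hΛ hΓ
  set G := meanResolvent D F Λ ν with hG
  set R := resolvent Λ (sumFamily D F) with hRdef
  set Q := resolvent Γ (sndFamily ι F) with hQdef
  set μ := (gaussianPi ι (N : NNReal)⁻¹).prod ν
  have hW := sumFamily_isHermitian hD hF
  have hW' := sndFamily_isHermitian (ι := ι) hF
  have hRb : ∀ z, ‖R z‖ ≤ c⁻¹ := norm_resolvent_le hc hΛ hW
  have hQb : ∀ z, ‖Q z‖ ≤ c⁻¹ := norm_resolvent_le hc hΓ hW'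
  have hRc : Continuous R := (contDiff_resolvent hc hΛ hW).continuous
  have hQc : Continuous Q := (contDiff_resolvent hc hΓ hW').continuous
  have hRi : Integrable R μ := integrable_of_continuous_of_bound hRc hRb
  have hQi : Integrable Q μ := integrable_of_continuous_of_bound hQc hQb
  let L := (kroneckerOneCLM k N).comp (covCLM a)
  have hkron : ∀ M, L M = covMap a M ⊗ₖ (1 : Matrix (Fin N) (Fin N) ℂ) := fun M => rfl
  have hTc : Continuous fun z => L (partialTrace (R z)) :=
    L.continuous.comp ((partialTraceCLM k N).continuous.comp hRc)
  have hTb : ∀ z, ‖L (partialTrace (R z))‖ ≤ ‖L‖ * (‖partialTraceCLM k N‖ * c⁻¹) := fun z =>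
    (L.le_opNorm _).trans (by
      gcongr
      exact ((partialTraceCLM k N).le_opNorm _).trans (by gcongr; exact hRb z))
  have hi1 : Integrable (fun z => Q z * L (partialTrace (R z)) * R z) μ :=
    integrable_of_continuous_of_bound ((hQc.mul hTc).mul hRc) fun z =>
      (norm_mul_le _ _).trans (mul_le_mul ((norm_mul_le _ _).trans
        (mul_le_mul (hQb z) (hTb z) (norm_nonneg _) (by positivity))) (hRb z) (norm_nonneg _)
        (by positivity))
  have hi2 : Integrable (fun z => Q z * L G * R z) μ :=
    integrable_of_continuous_of_bound (C := c⁻¹ * ‖L G‖ * c⁻¹) (by fun_prop) fun z =>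
      (norm_mul_le _ _).trans (mul_le_mul ((norm_mul_le _ _).trans (by gcongr; exact hQb z))
        (hRb z) (norm_nonneg _) (by positivity))
  -- In the resolvent identity the `T` parts cancel, leaving `S - 𝓡ₛ(G) ⊗ 1` in the middle.
  have hdiff : ∀ z, R z - Q z = Q z * linearFamily D z.1 * R z - Q z * L G * R z := fun z => by
    rw [hRdef, hQdef, resolvent_sub_resolvent hc hΛ hW hc hΓ hW', ← sub_mul, ← mul_sub]
    congr 2
    have h1 : (Λ - covMap a G) ⊗ₖ (1 : Matrix (Fin N) (Fin N) ℂ) = Λ ⊗ₖ 1 - L G :=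
      (kroneckerOneCLM k N).map_sub _ _
    rw [shifted, shifted, hΓΛ, h1]
    simp only [sumFamily, sndFamily, ContinuousLinearMap.coprod_apply,
      ContinuousLinearMap.comp_apply, ContinuousLinearMap.coe_snd']
    abel
  have hmain : ∫ z, R z ∂μ - ∫ z, Q z ∂μ
      = ∫ z, Q z * L (partialTrace (R z) - G) * R z ∂μ := by
    rw [← integral_sub hRi hQi]
    simp only [hdiff]
    rw [integral_sub hint hi2, hparts]
    simp only [← hkron]
    rw [← integral_sub hi1 hi2]
    simp only [map_sub, mul_sub, sub_mul]
  have hi3 : Integrable (fun z => Q z * L (partialTrace (R z) - G) * R z) μ := by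
    simp only [map_sub, mul_sub, sub_mul]
    exact hi1.sub hi2
  have h1 := congrArg (partialTraceCLM k N) hmain
  rw [map_sub, ← ContinuousLinearMap.integral_comp_comm _ hRi,
    ← ContinuousLinearMap.integral_comp_comm _ hQi,
    ← ContinuousLinearMap.integral_comp_comm _ hi3] at h1
  exact ⟨(partialTraceCLM k N).integrable_comp hi3, h1⟩

/-- Counting powers: each covariance is at most `B`, the geometric mean of two variance bounds,
which gives `k N⁻² c⁻⁵`. Summing over the entries `(u, v)` costs `k²`, and passing from entries to
the operator norm costs `k`, for a total of `k⁴`. -/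
lemma norm_meanResolvent_sub_le (hN : 1 ≤ N) (hD : IsGradientBounded D α)
    (hF : IsGradientBounded F β) (hα : 0 ≤ α) (hβ : 0 ≤ β)
    (hDa : ∀ B, ∑ i, D i * B * D i
      = (N : ℂ) • (covMap a (partialTrace B) ⊗ₖ (1 : Matrix (Fin N) (Fin N) ℂ)))
    (hc : 0 < c) (hΛ : ImGE c Λ) (hΓ : ImGE c Γ)
    (hΓΛ : Γ = Λ - covMap a (meanResolvent D F Λ ν)) {σ : ℝ} (hσ : 1 ≤ σ)
    (hν : PoincareInequality ν (σ / N)) :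
    ‖meanResolvent D F Λ ν
        - ∫ z, partialTrace (resolvent Γ (sndFamily ι F) z) ∂(gaussianPi ι (N : NNReal)⁻¹).prod ν‖
      ≤ 2 * k ^ 4 * σ * (∑ j, ‖a j‖ ^ 2) * (α + β) / N ^ 2 * c⁻¹ ^ 5 := by
  set A := ∑ j, ‖a j‖ ^ 2 with hA
  have hA0 : 0 ≤ A := by positivity
  have hN' : (0 : ℝ) < N := by exact_mod_cast hN
  set B := k / N ^ 2 * c⁻¹ ^ 5 * A * (2 * σ * (α + β)) with hB
  have hB0 : 0 ≤ B := by positivity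
  have hW := sumFamily_isHermitian hD hF
  have hW' := sndFamily_isHermitian (ι := ι) hF
  have hRb : ∀ z, ‖resolvent Λ (sumFamily D F) z‖ ≤ c⁻¹ := norm_resolvent_le hc hΛ hW
  have hQb : ∀ z, ‖resolvent Γ (sndFamily ι F) z‖ ≤ c⁻¹ := norm_resolvent_le hc hΓ hW'
  have hRc : Continuous (resolvent Λ (sumFamily D F)) := (contDiff_resolvent hc hΛ hW).continuous
  have hQc : Continuous (resolvent Γ (sndFamily ι F)) := (contDiff_resolvent hc hΓ hW').continuous
  obtain ⟨hint, heq⟩ := meanResolvent_sub_eq hN hD hF hDa hc hΛ hΓ hΓΛ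
  rw [heq]
  clear heq
  set G := meanResolvent D F Λ ν with hG
  set R := resolvent Λ (sumFamily D F) with hRdef
  set Q := resolvent Γ (sndFamily ι F) with hQdef
  set μ := (gaussianPi ι (N : NNReal)⁻¹).prod ν with hμ
  let h : Fin k → Fin k → (ι → ℝ) × (κ → ℝ) → ℂ := fun u v z => partialTrace (R z) u v
  let J : Fin k → Fin k → Matrix (Fin k × Fin N) (Fin k × Fin N) ℂ := fun u v =>
    covMap a (single u v 1) ⊗ₖ 1
  let l : Fin k → Fin k → Fin k → Fin k → (ι → ℝ) × (κ → ℝ) → ℂ := fun u v r t z =>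
    partialTrace (Q z * J u v * R z) r t
  have hJ : ∀ u v, ‖J u v‖ ≤ A := fun u v =>
    (norm_kronecker_one_le _).trans (norm_covMap_single_le a u v)
  have hhc : ∀ u v, Continuous (h u v) := fun u v => (partialTraceEntry N u v).continuous.comp hRc
  have hlc : ∀ u v r t, Continuous (l u v r t) := fun u v r t =>
    (partialTraceEntry N r t).continuous.comp (by fun_prop : Continuous fun z => Q z * J u v * R z)
  have hhb : ∀ u v z, ‖h u v z‖ ≤ ‖partialTraceEntry N u v‖ * c⁻¹ := fun u v z =>
    ((partialTraceEntry N u v).le_opNorm _).trans (by gcongr; exact hRb z)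
  have hlb : ∀ u v r t z, ‖l u v r t z‖ ≤ ‖partialTraceEntry N r t‖ * (c⁻¹ * A * c⁻¹) :=
    fun u v r t z => ((partialTraceEntry N r t).le_opNorm _).trans (by
      gcongr
      exact (norm_mul_le _ _).trans (mul_le_mul ((norm_mul_le _ _).trans
        (mul_le_mul (hQb z) (hJ u v) (norm_nonneg _) (by positivity))) (hRb z) (norm_nonneg _)
        (by positivity)))
  have hhi : ∀ u v, Integrable (h u v) μ := fun u v =>
    integrable_of_continuous_of_bound (hhc u v) (hhb u v)
  have hli : ∀ u v r t, Integrable (l u v r t) μ := fun u v r t =>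
    integrable_of_continuous_of_bound (hlc u v r t) (hlb u v r t)
  have hGh : ∀ u v, G u v = ∫ z, h u v z ∂μ := fun u v =>
    ((entryCLM u v).integral_comp_comm (integrable_partialTrace_resolvent (μ := μ) hc hΛ hW)).symm
  have hhi' : ∀ u v, Integrable (fun z => h u v z - G u v) μ := fun u v =>
    (hhi u v).sub (integrable_const _)
  have hhm : ∀ u v, MemLp (fun z => h u v z - G u v) 2 μ := fun u v =>
    (MemLp.of_bound (hhc u v).aestronglyMeasurable _ (ae_of_all _ (hhb u v))).sub (memLp_const _)
  have hlm : ∀ u v r t, MemLp (fun z => l u v r t z - ∫ w, l u v r t w ∂μ) 2 μ := fun u v r t =>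
    (MemLp.of_bound (hlc u v r t).aestronglyMeasurable _ (ae_of_all _ (hlb u v r t))).sub
      (memLp_const _)
  have hprod : ∀ u v r t, Integrable (fun z => (h u v z - G u v) * l u v r t z) μ :=
    fun u v r t => (hhi' u v).mul_bdd
      (hlc u v r t).aestronglyMeasurable (ae_of_all _ (hlb u v r t))
  have hcov : ∀ u v r t, ‖∫ z, (h u v z - G u v) * l u v r t z ∂μ‖ ≤ B := fun u v r t => by
    -- The first factor has mean zero, so the second may be centered at no cost. Both factors then
    -- have small second moment.
    have e1 : ∫ z, (h u v z - G u v) * l u v r t z ∂μ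
        = ∫ z, (h u v z - G u v) * (l u v r t z - ∫ w, l u v r t w ∂μ) ∂μ := by
      simp only [mul_sub]
      rw [integral_sub (hprod u v r t) ((hhi' u v).mul_const _),
        integral_mul_const, integral_sub (hhi u v) (integrable_const _), ← hGh]
      simp
    have hσN : 0 ≤ σ / N := by positivity
    have e2 := variance_partialTrace_resolvent_le hD hF hα hβ hc hΛ hν hσN (N : NNReal)⁻¹ u v
    have e3 := variance_partialTrace_resolvent_mul_le hD hF hα hβ hc hΛ hΓ hν hσN (N : NNReal)⁻¹
      (J u v) r t
    have e4 := norm_integral_mul_sq_le (hhm u v) (hlm u v r t)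
    rw [← e1] at e4
    refine le_of_sq_le_sq (e4.trans ?_) hB0
    have hpi : Real.pi ^ 2 / 8 ≤ 5 / 4 := by
      nlinarith [Real.pi_lt_d2, Real.pi_pos]
    have e5 : ∫ z, ‖h u v z - G u v‖ ^ 2 ∂μ
        ≤ k / N ^ 2 * c⁻¹ ^ 4 * (5 / 4 * α + σ * β) := by
      rw [hGh]
      refine e2.trans ?_
      calc _ = k / N ^ 2 * c⁻¹ ^ 4 * (Real.pi ^ 2 / 8 * α + σ * β) := by
            push_cast; field_simp
        _ ≤ _ := by gcongr
    have e6 : ∫ z, ‖l u v r t z - ∫ w, l u v r t w ∂μ‖ ^ 2 ∂μ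
        ≤ k / N ^ 2 * (c⁻¹ ^ 6 * A ^ 2) * (5 / 4 * α + 4 * σ * β) := by
      refine e3.trans ?_
      calc _ = k / N ^ 2 * (c⁻¹ ^ 6 * ‖J u v‖ ^ 2) * (Real.pi ^ 2 / 8 * α + 4 * σ * β) := by
            push_cast; field_simp
        _ ≤ _ := by gcongr; exact hJ u v
    -- Here `σ ≥ 1` is used, to absorb the Gaussian constant `5/4` and the mixed term into `4 σ² (α
    -- + β)²`.
    have e7 : (5 / 4 * α + σ * β) * (5 / 4 * α + 4 * σ * β) ≤ (2 * σ * (α + β)) ^ 2 := by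
      have h1 : α ^ 2 ≤ σ ^ 2 * α ^ 2 := le_mul_of_one_le_left (by positivity) (by nlinarith)
      have h2 : σ * (α * β) ≤ σ ^ 2 * (α * β) :=
        mul_le_mul_of_nonneg_right (by nlinarith) (by positivity)
      have h3 : 0 ≤ σ ^ 2 * (α * β) := by positivity
      nlinarith
    calc _ ≤ (k / N ^ 2 * c⁻¹ ^ 4 * (5 / 4 * α + σ * β))
          * (k / N ^ 2 * (c⁻¹ ^ 6 * A ^ 2) * (5 / 4 * α + 4 * σ * β)) :=
          mul_le_mul e5 e6 (integral_nonneg fun _ => by positivity) (by positivity)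
      _ = (k / N ^ 2 * c⁻¹ ^ 5 * A) ^ 2 * ((5 / 4 * α + σ * β) * (5 / 4 * α + 4 * σ * β)) := by
          ring
      _ ≤ (k / N ^ 2 * c⁻¹ ^ 5 * A) ^ 2 * (2 * σ * (α + β)) ^ 2 := by gcongr
      _ = B ^ 2 := by rw [hB]; ring
  have hexp : ∀ z, partialTrace (Q z * (covMap a (partialTrace (R z) - G) ⊗ₖ 1) * R z)
      = Matrix.of fun r t => ∑ u, ∑ v, (h u v z - G u v) * l u v r t z := fun z => by
    ext r t
    rw [covMap_eq_sum, ← kroneckerOneCLM_apply]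
    simp only [map_sum, map_smul, Finset.mul_sum, Finset.sum_mul]
    rw [← partialTraceEntry_apply]
    simp only [map_sum]
    rw [of_apply]
    refine Finset.sum_congr rfl fun u _ => Finset.sum_congr rfl fun v _ => ?_
    rw [mul_smul_comm, smul_mul_assoc, partialTraceEntry_apply, ← partialTraceCLM_apply, map_smul]
    rfl
  have hentry : ∀ r t, ‖(∫ z, partialTrace
      (Q z * (covMap a (partialTrace (R z) - G) ⊗ₖ 1) * R z) ∂μ) r t‖ ≤ k * (k * B) := fun r t => by
    have e1 := ((entryCLM r t).integral_comp_comm hint).symm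
    simp only [hexp, entryCLM_apply, of_apply] at e1 ⊢
    rw [e1, integral_finsetSum _ fun u _ => integrable_finsetSum _ fun v _ => hprod u v r t]
    refine (norm_sum_le_of_le (f := fun u => _) (n := fun _ => (k : ℝ) * B) _ fun u _ => ?_).trans
      (by simp)
    rw [integral_finsetSum _ fun v _ => hprod u v r t]
    exact (norm_sum_le_of_le _ fun v _ => hcov u v r t).trans (by simp)
  refine (norm_le_of_entry_le _ (by positivity) hentry).trans (le_of_eq ?_)
  rw [hB]
  ring

end SchwingerDyson

/-! ### Analytic dependence on the spectral parameter -/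

section Analyticity

open scoped BoundedContinuousFunction

variable {V : Type*} [NormedAddCommGroup V] [NormedSpace ℝ V] [MeasurableSpace V]
  [OpensMeasurableSpace V] [SecondCountableTopology V] {k N : ℕ}

/-- Integration of the partial trace of a bounded continuous matrix-valued function. -/
def integralPartialTraceCLM (k N : ℕ) (μ : Measure V) [IsProbabilityMeasure μ] :
    (V →ᵇ Matrix (Fin k × Fin N) (Fin k × Fin N) ℂ) →L[ℂ] Matrix (Fin k) (Fin k) ℂ :=
  have hi : ∀ f : V →ᵇ Matrix (Fin k × Fin N) (Fin k × Fin N) ℂ, Integrable f μ := fun f =>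
    integrable_of_continuous_of_bound f.continuous f.norm_coe_le_norm
  LinearMap.mkContinuous
    { toFun := fun f => partialTraceCLM k N (∫ z, f z ∂μ)
      map_add' := fun f g => by
        rw [← map_add, ← integral_add (hi f) (hi g)]
        rfl
      map_smul' := fun r f => by
        rw [RingHom.id_apply, ← map_smul, ← integral_smul]
        rfl }
    ‖partialTraceCLM k N‖ fun f => by
      refine ((partialTraceCLM k N).le_opNorm _).trans ?_
      gcongr
      refine (norm_integral_le_of_norm_le_const (ae_of_all _ f.norm_coe_le_norm)).trans ?_
      simp

lemma integralPartialTraceCLM_apply (μ : Measure V) [IsProbabilityMeasure μ]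
    (f : V →ᵇ Matrix (Fin k × Fin N) (Fin k × Fin N) ℂ) :
    integralPartialTraceCLM k N μ f = ∫ z, partialTrace (f z) ∂μ :=
  ((partialTraceCLM k N).integral_comp_comm
    (integrable_of_continuous_of_bound f.continuous f.norm_coe_le_norm)).symm

/-- The constant functions `M ⊗ 1_N`, linearly in `M`. -/
def constKroneckerCLM (V : Type*) [TopologicalSpace V] (k N : ℕ) :
    Matrix (Fin k) (Fin k) ℂ →L[ℂ] (V →ᵇ Matrix (Fin k × Fin N) (Fin k × Fin N) ℂ) :=
  LinearMap.toContinuousLinearMap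
    { toFun := fun M => BoundedContinuousFunction.const V (kroneckerOneCLM k N M)
      map_add' := fun A B => by ext1 z; simp
      map_smul' := fun c A => by ext1 z; simp }

/-- The factorization `Λ ⊗ 1 - W = (Λ₀ ⊗ 1 - W)(1 + R₀ ((Λ - Λ₀) ⊗ 1))` holds uniformly in `z`,
since `R₀` is bounded. The second factor is an affine function of `Λ` with values in a Banach
algebra, equal to `1` at `Λ₀`, where inversion is analytic. No differentiation under the integral is
needed. -/
lemma analyticAt_integral_partialTrace_resolvent {μ : Measure V} [IsProbabilityMeasure μ]
    {W : V →L[ℝ] Matrix (Fin k × Fin N) (Fin k × Fin N) ℂ} {c : ℝ} (hc : 0 < c)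
    {Λ₀ : Matrix (Fin k) (Fin k) ℂ} (hΛ : ImGE c Λ₀) (hW : ∀ z, (W z).IsHermitian) :
    AnalyticAt ℂ (fun Λ => ∫ z, partialTrace (resolvent Λ W z) ∂μ) Λ₀ := by
  let R₀ : V →ᵇ Matrix (Fin k × Fin N) (Fin k × Fin N) ℂ :=
    BoundedContinuousFunction.ofNormedAddCommGroup (resolvent Λ₀ W)
      (contDiff_resolvent hc hΛ hW).continuous c⁻¹ (norm_resolvent_le hc hΛ hW)
  let φ : Matrix (Fin k) (Fin k) ℂ → (V →ᵇ Matrix (Fin k × Fin N) (Fin k × Fin N) ℂ) :=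
    fun Λ => 1 + R₀ * constKroneckerCLM V k N (Λ - Λ₀)
  have hφ : AnalyticAt ℂ φ Λ₀ :=
    analyticAt_const.add (analyticAt_const.mul
      (((constKroneckerCLM V k N).analyticAt _).comp (analyticAt_id.sub analyticAt_const)))
  have hφ₀ : φ Λ₀ = ((1 : (V →ᵇ Matrix (Fin k × Fin N) (Fin k × Fin N) ℂ)ˣ) :
      V →ᵇ Matrix (Fin k × Fin N) (Fin k × Fin N) ℂ) := by simp [φ]
  have hinv : AnalyticAt ℂ (fun Λ => Ring.inverse (φ Λ)) Λ₀ :=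
    AnalyticAt.comp (g := Ring.inverse) (f := φ) (by rw [hφ₀]; exact analyticAt_inverse _) hφ
  have hmain : AnalyticAt ℂ
      (fun Λ => integralPartialTraceCLM k N μ (Ring.inverse (φ Λ) * R₀)) Λ₀ :=
    ((integralPartialTraceCLM k N μ).analyticAt _).comp (hinv.mul analyticAt_const)
  refine hmain.congr ?_
  have hunit : ∀ᶠ Λ in nhds Λ₀, IsUnit (φ Λ) := by
    have h1 : {f : V →ᵇ Matrix (Fin k × Fin N) (Fin k × Fin N) ℂ | IsUnit f} ∈ nhds (φ Λ₀) := by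
      rw [hφ₀]
      exact Units.nhds _
    exact hφ.continuousAt h1
  filter_upwards [hunit] with Λ hu
  rw [integralPartialTraceCLM_apply]
  refine integral_congr_ae (ae_of_all _ fun z => ?_)
  simp only
  congr 1
  obtain ⟨u, hu⟩ := hu
  have h1 : (Ring.inverse (φ Λ)) z = (φ Λ z)⁻¹ := by
    rw [← hu, Ring.inverse_unit]
    refine (inv_eq_left_inv ?_).symm
    have h2 := congrArg (fun f : V →ᵇ Matrix (Fin k × Fin N) (Fin k × Fin N) ℂ => f z) u.inv_mul
    exact h2
  have h3 : φ Λ z = 1 + (shifted Λ₀ (W z))⁻¹ * ((Λ - Λ₀) ⊗ₖ 1) := rfl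
  have h4 : (Λ - Λ₀) ⊗ₖ (1 : Matrix (Fin N) (Fin N) ℂ) = Λ ⊗ₖ 1 - Λ₀ ⊗ₖ 1 :=
    (kroneckerOneCLM k N).map_sub _ _
  have h5 : shifted Λ (W z) = shifted Λ₀ (W z) * φ Λ z := by
    have h6 := (isUnit_iff_isUnit_det _).mp (isUnit_shifted hc hΛ (hW z))
    rw [h3, mul_add, mul_one, ← mul_assoc, mul_nonsing_inv _ h6, one_mul, h4, shifted, shifted]
    abel
  change (Ring.inverse (φ Λ)) z * resolvent Λ₀ W z = _
  rw [h1, resolvent, resolvent, h5, Matrix.mul_inv_rev]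

end Analyticity

/-! ### Sign of the imaginary part of the mean resolvent -/

section ImaginaryPartOfMean

variable {V : Type*} [NormedAddCommGroup V] [NormedSpace ℝ V] [MeasurableSpace V]
  [OpensMeasurableSpace V] [SecondCountableTopology V] {k N : ℕ}

/-- The quadratic form `M ↦ x* M x` as a continuous linear map. -/
def quadFormCLM {n : Type*} [Fintype n] [DecidableEq n] (x : n → ℂ) : Matrix n n ℂ →L[ℂ] ℂ :=
  LinearMap.toContinuousLinearMap
    { toFun := fun M => quadForm M x
      map_add' := fun A B => quadForm_add A B x
      map_smul' := fun c A => quadForm_smul c A x }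

lemma im_quadForm_integral_resolvent_nonpos {μ : Measure V} [IsProbabilityMeasure μ]
    {W : V →L[ℝ] Matrix (Fin k × Fin N) (Fin k × Fin N) ℂ} {c : ℝ} (hc : 0 < c)
    {Λ : Matrix (Fin k) (Fin k) ℂ} (hΛ : ImGE c Λ) (hW : ∀ z, (W z).IsHermitian) (x : Fin k → ℂ) :
    (quadForm (∫ z, partialTrace (resolvent Λ W z) ∂μ) x).im ≤ 0 := by
  have h1 := (Complex.imCLM.comp ((quadFormCLM x).restrictScalars ℝ)).integral_comp_comm
    (integrable_partialTrace_resolvent (μ := μ) hc hΛ hW)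
  change _ = (quadForm (∫ z, partialTrace (resolvent Λ W z) ∂μ) x).im at h1
  rw [← h1]
  refine integral_nonpos fun z => ?_
  exact im_quadForm_partialTrace_nonpos (fun w => (hΛ.shifted (hW z)).im_quadForm_inv_nonpos hc w) x

end ImaginaryPartOfMean

/-! ### The two concrete frames of Hermitian matrices -/

section ConcreteFrames

variable {N : ℕ}

lemma IsHermitianFrame.sum_trace_smul {ι : Type*} [Fintype ι] {E : ι → Matrix (Fin N) (Fin N) ℂ}
    (hE : IsHermitianFrame E) (M : Matrix (Fin N) (Fin N) ℂ) :
    ∑ i, trace (E i * M) • E i = M := by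
  ext c d
  rw [Matrix.sum_apply]
  have h1 : ∀ i, (trace (E i * M) • E i) c d = ∑ a, ∑ b, E i a b * E i c d * M b a := fun i => by
    simp only [Matrix.smul_apply, smul_eq_mul, trace, diag_apply, mul_apply, Finset.sum_mul]
    exact Finset.sum_congr rfl fun a _ => Finset.sum_congr rfl fun b _ => by ring
  simp only [h1]
  rw [Finset.sum_comm]
  have h2 : ∀ a, ∑ i, ∑ b, E i a b * E i c d * M b a = if a = d then M c a else 0 := fun a => by
    rw [Finset.sum_comm]
    simp_rw [← Finset.sum_mul, hE.sum_mul]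
    by_cases h : a = d <;> simp [h]
  simp [h2]

/-- The completeness relation for matrix units, symmetrized in `(n, m)`; both concrete frames reduce
to it. -/
lemma sum_single_mul_single (a b c d : Fin N) :
    ∑ n, ∑ m, ((single n m (1 : ℂ) : Matrix (Fin N) (Fin N) ℂ) a b
        * (single m n (1 : ℂ) : Matrix (Fin N) (Fin N) ℂ) c d
      + (single m n (1 : ℂ) : Matrix (Fin N) (Fin N) ℂ) a b
        * (single n m (1 : ℂ) : Matrix (Fin N) (Fin N) ℂ) c d)
      = if a = d ∧ b = c then 2 else 0 := by
  have h1 : ∑ n, ∑ m, (single n m (1 : ℂ) : Matrix (Fin N) (Fin N) ℂ) a b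
        * (single m n (1 : ℂ) : Matrix (Fin N) (Fin N) ℂ) c d
      = if a = d ∧ b = c then 1 else 0 := by
    simp only [single_apply]
    rw [Finset.sum_eq_single a, Finset.sum_eq_single b]
    all_goals simp +contextual [eq_comm, and_comm]
  simp only [Finset.sum_add_distrib]
  rw [h1, Finset.sum_comm, h1]
  split_ifs <;> norm_num

/-- The orthonormal basis of Hermitian matrices dual to `hermitianCoords`. -/
def coordFrame (N : ℕ) (i : Fin N × Fin N) : Matrix (Fin N) (Fin N) ℂ :=
  if i.1 = i.2 then single i.1 i.1 1
  else if i.1 < i.2 then ((√2 : ℝ) : ℂ)⁻¹ • (single i.1 i.2 1 + single i.2 i.1 1)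
  else (((√2 : ℝ) : ℂ)⁻¹ * Complex.I) • (single i.2 i.1 1 - single i.1 i.2 1)

lemma inv_sqrt_two_mul_self : ((√2 : ℝ) : ℂ)⁻¹ * ((√2 : ℝ) : ℂ)⁻¹ = 1 / 2 := by
  rw [← mul_inv, ← Complex.ofReal_mul, Real.mul_self_sqrt (by norm_num)]
  norm_num

lemma isHermitianFrame_coordFrame : IsHermitianFrame (coordFrame N) where
  isHermitian i := by
    unfold coordFrame
    split_ifs
    · simp [IsHermitian, conjTranspose_single]
    · simp [IsHermitian, conjTranspose_single, add_comm]
    · simp only [IsHermitian, conjTranspose_smul, conjTranspose_sub, conjTranspose_single,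
        star_one, star_mul', star_inv₀, Complex.star_def, Complex.conj_ofReal, Complex.conj_I]
      rw [mul_neg, neg_smul, ← smul_neg, neg_sub]
  sum_mul a b c d := by
    rw [Fintype.sum_prod_type]
    set f : Fin N → Fin N → ℂ := fun n m => coordFrame N (n, m) a b * coordFrame N (n, m) c d
    -- The real and imaginary directions of one entry are stored at transposed positions, so only
    -- the symmetrized sum simplifies. The relation is therefore proved for twice the sum.
    have h1 : ∀ n m, f n m + f m n
        = (single n m (1 : ℂ) : Matrix (Fin N) (Fin N) ℂ) a b
            * (single m n (1 : ℂ) : Matrix (Fin N) (Fin N) ℂ) c d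
          + (single m n (1 : ℂ) : Matrix (Fin N) (Fin N) ℂ) a b
            * (single n m (1 : ℂ) : Matrix (Fin N) (Fin N) ℂ) c d := by
      have key : ∀ n m, n < m → f n m + f m n
        = (single n m (1 : ℂ) : Matrix (Fin N) (Fin N) ℂ) a b
            * (single m n (1 : ℂ) : Matrix (Fin N) (Fin N) ℂ) c d
          + (single m n (1 : ℂ) : Matrix (Fin N) (Fin N) ℂ) a b
            * (single n m (1 : ℂ) : Matrix (Fin N) (Fin N) ℂ) c d := fun n m h => by
        simp only [f, coordFrame, h.ne, h.ne', h, h.not_gt, if_true, if_false, Matrix.smul_apply,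
          Matrix.add_apply, Matrix.sub_apply, smul_eq_mul]
        linear_combination
          (((single n m (1 : ℂ) : Matrix (Fin N) (Fin N) ℂ) a b
              + (single m n (1 : ℂ) : Matrix (Fin N) (Fin N) ℂ) a b)
            * ((single n m (1 : ℂ) : Matrix (Fin N) (Fin N) ℂ) c d
              + (single m n (1 : ℂ) : Matrix (Fin N) (Fin N) ℂ) c d)
          - ((single n m (1 : ℂ) : Matrix (Fin N) (Fin N) ℂ) a b
              - (single m n (1 : ℂ) : Matrix (Fin N) (Fin N) ℂ) a b)
            * ((single n m (1 : ℂ) : Matrix (Fin N) (Fin N) ℂ) c d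
              - (single m n (1 : ℂ) : Matrix (Fin N) (Fin N) ℂ) c d)) * inv_sqrt_two_mul_self
          + ((single n m (1 : ℂ) : Matrix (Fin N) (Fin N) ℂ) a b
              - (single m n (1 : ℂ) : Matrix (Fin N) (Fin N) ℂ) a b)
            * ((single n m (1 : ℂ) : Matrix (Fin N) (Fin N) ℂ) c d
              - (single m n (1 : ℂ) : Matrix (Fin N) (Fin N) ℂ) c d)
            * ((√2 : ℝ) : ℂ)⁻¹ ^ 2 * Complex.I_mul_I
      intro n m
      rcases lt_trichotomy n m with h | h | h
      · exact key n m h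
      · subst h; simp [f, coordFrame]
      · rw [add_comm, key m n h, add_comm]
    have h2 : ∑ n, ∑ m, f n m + ∑ n, ∑ m, f n m = if a = d ∧ b = c then 2 else 0 := by
      conv_lhs => rw [Finset.sum_comm (f := fun n m => f n m)]
      rw [Finset.sum_comm]
      nth_rewrite 2 [Finset.sum_comm]
      simp only [← Finset.sum_add_distrib, h1]
      exact sum_single_mul_single a b c d
    split_ifs at h2 ⊢ <;> linear_combination h2 / 2

lemma trace_single_one_mul (n m : Fin N) (M : Matrix (Fin N) (Fin N) ℂ) :
    trace (single n m (1 : ℂ) * M) = M m n := by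
  simp [trace, mul_apply, single_apply, ite_and]

lemma trace_coordFrame_mul {M : Matrix (Fin N) (Fin N) ℂ} (hM : M.IsHermitian)
    (i : Fin N × Fin N) : trace (coordFrame N i * M) = (hermitianCoords M i : ℂ) := by
  have h2 : ((√2 : ℝ) : ℂ)⁻¹ * 2 = ((√2 : ℝ) : ℂ) := by
    have h0 : ((√2 : ℝ) : ℂ) ≠ 0 := by simp
    have h3 : ((√2 : ℝ) : ℂ) * ((√2 : ℝ) : ℂ) = 2 := by
      rw [← Complex.ofReal_mul, Real.mul_self_sqrt (by norm_num)]
      norm_num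
    field_simp
    rw [pow_two, h3]
  unfold coordFrame hermitianCoords
  split_ifs with h h'
  · rw [trace_single_one_mul]
    exact (Complex.conj_eq_iff_re.mp (hM.apply i.1 i.1)).symm
  · rw [smul_mul_assoc, trace_smul, add_mul, trace_add, trace_single_one_mul, trace_single_one_mul,
      ← hM.apply i.2 i.1, Complex.star_def, add_comm, Complex.add_conj, smul_eq_mul]
    push_cast
    rw [← mul_assoc, h2]
  · rw [smul_mul_assoc, trace_smul, sub_mul, trace_sub, trace_single_one_mul, trace_single_one_mul,
      ← hM.apply i.1 i.2, Complex.star_def, ← neg_sub, Complex.sub_conj, smul_eq_mul]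
    push_cast
    linear_combination (M i.2 i.1).im * h2 - ((√2 : ℝ) : ℂ)⁻¹ * 2 * (M i.2 i.1).im * Complex.I_mul_I

/-- The Parseval frame of Hermitian matrices dual to the real and imaginary parts of all the
entries. -/
def entryFrame (N : ℕ) : (Fin N × Fin N) ⊕ (Fin N × Fin N) → Matrix (Fin N) (Fin N) ℂ :=
  Sum.elim (fun i => (1 / 2 : ℂ) • (single i.1 i.2 1 + single i.2 i.1 1))
    (fun i => (Complex.I / 2) • (single i.1 i.2 1 - single i.2 i.1 1))

/-- These `2N²` matrices span a space of dimension `N²`: the family is redundant, but the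
coefficients `1/2` make it tight with frame constant one. Hence the gradient bound is the same as
for an orthonormal basis. -/
lemma isHermitianFrame_entryFrame : IsHermitianFrame (entryFrame N) where
  isHermitian i := by
    rcases i with i | i
    · simp [entryFrame, IsHermitian, conjTranspose_single, add_comm]
    · simp only [entryFrame, Sum.elim_inr, IsHermitian, conjTranspose_smul, conjTranspose_sub,
        conjTranspose_single, star_one, Complex.star_def, map_div₀, Complex.conj_I]
      rw [← neg_sub, smul_neg, ← neg_smul]
      simp [neg_div, Complex.conj_ofNat]
  sum_mul a b c d := by
    rw [Fintype.sum_sum_type, Fintype.sum_prod_type, Fintype.sum_prod_type,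
      ← Finset.sum_add_distrib]
    have h := sum_single_mul_single a b c d
    have h1 : ∀ n m : Fin N, entryFrame N (Sum.inl (n, m)) a b * entryFrame N (Sum.inl (n, m)) c d
        + entryFrame N (Sum.inr (n, m)) a b * entryFrame N (Sum.inr (n, m)) c d
        = ((single n m (1 : ℂ) : Matrix (Fin N) (Fin N) ℂ) a b
            * (single m n (1 : ℂ) : Matrix (Fin N) (Fin N) ℂ) c d
          + (single m n (1 : ℂ) : Matrix (Fin N) (Fin N) ℂ) a b
            * (single n m (1 : ℂ) : Matrix (Fin N) (Fin N) ℂ) c d) * (1 / 2) := fun n m => by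
      simp only [entryFrame, Sum.elim_inl, Sum.elim_inr, Matrix.smul_apply,
          Matrix.add_apply, Matrix.sub_apply, smul_eq_mul]
      linear_combination
        ((single n m (1 : ℂ) : Matrix (Fin N) (Fin N) ℂ) a b
              - (single m n (1 : ℂ) : Matrix (Fin N) (Fin N) ℂ) a b)
            * ((single n m (1 : ℂ) : Matrix (Fin N) (Fin N) ℂ) c d
              - (single m n (1 : ℂ) : Matrix (Fin N) (Fin N) ℂ) c d) / 4 * Complex.I_mul_I
    simp only [← Finset.sum_add_distrib, h1, ← Finset.sum_mul, h]
    split_ifs <;> norm_num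

lemma trace_entryFrame_mul_inl {M : Matrix (Fin N) (Fin N) ℂ} (hM : M.IsHermitian)
    (n m : Fin N) : trace (entryFrame N (Sum.inl (n, m)) * M) = ((M n m).re : ℂ) := by
  rw [entryFrame, Sum.elim_inl, smul_mul_assoc, trace_smul, add_mul, trace_add, trace_single_one_mul,
    trace_single_one_mul, ← hM.apply m n, Complex.star_def, add_comm, Complex.add_conj, smul_eq_mul]
  push_cast
  ring

lemma trace_entryFrame_mul_inr {M : Matrix (Fin N) (Fin N) ℂ} (hM : M.IsHermitian)
    (n m : Fin N) : trace (entryFrame N (Sum.inr (n, m)) * M) = ((M n m).im : ℂ) := by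
  rw [entryFrame, Sum.elim_inr, smul_mul_assoc, trace_smul, sub_mul, trace_sub, trace_single_one_mul,
    trace_single_one_mul, ← hM.apply m n, Complex.star_def, ← neg_sub, Complex.sub_conj, smul_eq_mul]
  push_cast
  linear_combination -((M n m).im : ℂ) * Complex.I_mul_I

end ConcreteFrames

/-! ### Block matrices as linear families in real coordinates -/

section Coordinates

variable {k N p q : ℕ}

lemma measurable_matrix_entry (a b : Fin N) :
    Measurable fun M : Matrix (Fin N) (Fin N) ℂ => M a b :=
  (measurable_pi_apply b).comp (measurable_pi_apply (X := fun _ : Fin N => Fin N → ℂ) a)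

lemma measurable_hermitianCoords :
    Measurable (hermitianCoords : Matrix (Fin N) (Fin N) ℂ → Fin N × Fin N → ℝ) := by
  refine measurable_pi_iff.mpr fun i => ?_
  unfold hermitianCoords
  split_ifs
  · exact Complex.measurable_re.comp (measurable_matrix_entry _ _)
  · exact (Complex.measurable_re.comp (measurable_matrix_entry _ _)).const_mul _
  · exact (Complex.measurable_im.comp (measurable_matrix_entry _ _)).const_mul _

lemma measurable_realEntries :
    Measurable (realEntries : (Fin q → Matrix (Fin N) (Fin N) ℂ) → _) := by
  refine measurable_pi_iff.mpr fun i => ?_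
  rcases i with i | i
  · exact Complex.measurable_re.comp ((measurable_matrix_entry _ _).comp (measurable_pi_apply i.1))
  · exact Complex.measurable_im.comp ((measurable_matrix_entry _ _).comp (measurable_pi_apply i.1))

/-- The Hermitian coordinates of a family of matrices. -/
def familyCoords (X : Fin p → Matrix (Fin N) (Fin N) ℂ) : Fin p × (Fin N × Fin N) → ℝ :=
  fun i => hermitianCoords (X i.1) i.2

lemma measurable_familyCoords :
    Measurable (familyCoords : (Fin p → Matrix (Fin N) (Fin N) ℂ) → _) :=
  measurable_pi_iff.mpr fun i =>
    (measurable_pi_apply i.2).comp (measurable_hermitianCoords.comp (measurable_pi_apply i.1))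

lemma kronecker_sum_smul {ι : Type*} [Fintype ι] (a : Matrix (Fin k) (Fin k) ℂ)
    (E : ι → Matrix (Fin N) (Fin N) ℂ) (x : ι → ℂ) :
    a ⊗ₖ (∑ i, x i • E i) = ∑ i, x i • (a ⊗ₖ E i) := by
  ext i j
  simp [Matrix.sum_apply, kroneckerMap_apply, Finset.mul_sum, mul_left_comm]

lemma blockSum_eq_linearFamily (a : Fin p → Matrix (Fin k) (Fin k) ℂ)
    {X : Fin p → Matrix (Fin N) (Fin N) ℂ} (hX : ∀ j, (X j).IsHermitian) :
    blockSum a X = linearFamily (blockFrame a (coordFrame N)) (familyCoords X) := by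
  rw [linearFamily_apply, Fintype.sum_prod_type, blockSum]
  refine Finset.sum_congr rfl fun j _ => ?_
  conv_lhs => rw [← isHermitianFrame_coordFrame.sum_trace_smul (X j)]
  simp only [trace_coordFrame_mul (hX j)]
  rw [kronecker_sum_smul]
  exact Finset.sum_congr rfl fun i _ => by rw [Complex.coe_smul]; rfl

/-- The block matrices dual to `realEntries`. -/
def entryBlockFrame (b : Fin q → Matrix (Fin k) (Fin k) ℂ) (N : ℕ)
    (i : (Fin q × Fin N × Fin N) ⊕ (Fin q × Fin N × Fin N)) :
    Matrix (Fin k × Fin N) (Fin k × Fin N) ℂ :=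
  blockFrame b (entryFrame N) ((Equiv.prodSumDistrib _ _ _).symm i)

/-- The Poincaré hypothesis concerns functions on all of `ℝ^{2qN²}`, whereas the resolvent is
controlled only at Hermitian matrices. The family on the right amounts to replacing each matrix by
its Hermitian part: it is Hermitian everywhere and agrees with `T` on Hermitian data. -/
lemma blockSum_eq_linearFamily_entryBlockFrame (b : Fin q → Matrix (Fin k) (Fin k) ℂ)
    {Y : Fin q → Matrix (Fin N) (Fin N) ℂ} (hY : ∀ j, (Y j).IsHermitian) :
    blockSum b Y = linearFamily (entryBlockFrame b N) (realEntries Y) := by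
  rw [linearFamily_apply, blockSum,
    ← Equiv.sum_comp (Equiv.prodSumDistrib (Fin q) (Fin N × Fin N) (Fin N × Fin N)),
    Fintype.sum_prod_type]
  refine Finset.sum_congr rfl fun j _ => ?_
  conv_lhs => rw [← isHermitianFrame_entryFrame.sum_trace_smul (Y j)]
  rw [kronecker_sum_smul]
  refine Finset.sum_congr rfl fun i _ => ?_
  rcases i with ⟨n, m⟩ | ⟨n, m⟩
  · rw [trace_entryFrame_mul_inl (hY j), Complex.coe_smul]
    rfl
  · rw [trace_entryFrame_mul_inr (hY j), Complex.coe_smul]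
    rfl

lemma isGradientBounded_blockFrame {ι : Type*} [Fintype ι] {E : ι → Matrix (Fin N) (Fin N) ℂ}
    (hE : IsHermitianFrame E) (hN : 1 ≤ N) {a : Fin p → Matrix (Fin k) (Fin k) ℂ}
    (ha : ∀ j, (a j).IsHermitian) :
    IsGradientBounded (blockFrame a E) (∑ j, ‖a j‖ ^ 2) where
  isHermitian := isHermitian_blockFrame hE ha
  sum_le A B u v := sum_blockFrame_norm_sq_partialTrace_le hE hN A B u v

lemma isGradientBounded_entryBlockFrame (hN : 1 ≤ N) {b : Fin q → Matrix (Fin k) (Fin k) ℂ}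
    (hb : ∀ j, (b j).IsHermitian) :
    IsGradientBounded (entryBlockFrame b N) (∑ j, ‖b j‖ ^ 2) where
  isHermitian i := isHermitian_blockFrame isHermitianFrame_entryFrame hb _
  sum_le A B u v := by
    refine le_trans (le_of_eq ?_) (sum_blockFrame_norm_sq_partialTrace_le (a := b)
      isHermitianFrame_entryFrame hN A B u v)
    exact Equiv.sum_comp (Equiv.prodSumDistrib (Fin q) (Fin N × Fin N) (Fin N × Fin N)).symm
      fun i => ‖partialTrace (A * blockFrame b (entryFrame N) i * B) u v‖ ^ 2

end Coordinates

/-! ### Transfer to the product of the Gaussian law and the law of `Y` -/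

section Laws

variable {Ω : Type*} [MeasurableSpace Ω] {P : Measure Ω} [IsProbabilityMeasure P] {k N p : ℕ}

/-- Independence between the matrices and independence of the coordinates within each matrix combine
into joint independence of all coordinates. -/
lemma map_familyCoords_eq_gaussianPi {X : Fin p → Ω → Matrix (Fin N) (Fin N) ℂ}
    (hX : ∀ j, IsGUE P (X j)) (hX_indep : iIndepFun X P) :
    P.map (fun ω => familyCoords fun j => X j ω)
      = gaussianPi (Fin p × (Fin N × Fin N)) (N : NNReal)⁻¹ := by
  have hm : ∀ j i, Measurable fun ω => hermitianCoords (X j ω) i := fun j i =>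
    (measurable_pi_apply i).comp (measurable_hermitianCoords.comp (hX j).measurable)
  have h1 : iIndepFun (fun j ω => hermitianCoords (X j ω)) P :=
    hX_indep.comp (fun _ => hermitianCoords) fun _ => measurable_hermitianCoords
  have hmarg : ∀ j i, P.map (fun ω => hermitianCoords (X j ω) i)
      = gaussianReal 0 (N : NNReal)⁻¹ := fun j i => by
    have h2 := (measurePreserving_eval
      (fun _ : Fin N × Fin N => gaussianReal 0 (N : NNReal)⁻¹) i).map_eq
    have h3 := Measure.map_map (μ := P) (measurable_pi_apply i)
      (measurable_hermitianCoords.comp (hX j).measurable)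
    exact h3.symm.trans ((congrArg _ (hX j).hasLaw.map_eq).trans h2)
  have h2 : ∀ j, iIndepFun (fun i ω => hermitianCoords (X j ω) i) P := fun j => by
    rw [iIndepFun_iff_map_fun_eq_pi_map fun i => (hm j i).aemeasurable]
    simp only [hmarg]
    exact (hX j).hasLaw.map_eq
  have h3 := iIndepFun_uncurry' (X := fun j i ω => hermitianCoords (X j ω) i) hm h1 h2
  have h4 := (iIndepFun_iff_map_fun_eq_pi_map
    (f := fun (i : Fin p × (Fin N × Fin N)) ω => hermitianCoords (X i.1 ω) i.2)
    fun i => (hm i.1 i.2).aemeasurable).mp h3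
  simp only [hmarg] at h4
  exact h4

lemma stieltjes_eq_integral_map {V : Type*} [NormedAddCommGroup V] [NormedSpace ℝ V]
    [MeasurableSpace V] [BorelSpace V] [SecondCountableTopology V]
    {Z : Ω → Matrix (Fin k × Fin N) (Fin k × Fin N) ℂ} {φ : Ω → V} (hφ : Measurable φ)
    {W : V →L[ℝ] Matrix (Fin k × Fin N) (Fin k × Fin N) ℂ} (hW : ∀ z, (W z).IsHermitian)
    (hZ : ∀ᵐ ω ∂P, Z ω = W (φ ω)) {c : ℝ} (hc : 0 < c) {Λ : Matrix (Fin k) (Fin k) ℂ}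
    (hΛ : ImGE c Λ) :
    StieltjesDefined P Z Λ ∧
      stieltjes P Z Λ = ∫ z, partialTrace (resolvent Λ W z) ∂(P.map φ) := by
  have : IsProbabilityMeasure (P.map φ) := Measure.isProbabilityMeasure_map hφ.aemeasurable
  have hi := integrable_partialTrace_resolvent (μ := P.map φ) hc hΛ hW
  have hae : (fun ω => partialTrace (shifted Λ (Z ω))⁻¹)
      =ᵐ[P] fun ω => partialTrace (resolvent Λ W (φ ω)) := by
    filter_upwards [hZ] with ω hω
    rw [hω, resolvent]
  refine ⟨⟨?_, (hi.comp_measurable hφ).congr hae.symm⟩, ?_⟩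
  · filter_upwards [hZ] with ω hω
    rw [hω]
    exact isUnit_shifted hc hΛ (hW _)
  · rw [stieltjes, integral_congr_ae hae, integral_map hφ.aemeasurable hi.aestronglyMeasurable]

end Laws

lemma sum_sq_add_sum_sq_le {p q : ℕ} (x : Fin p → ℝ) (y : Fin q → ℝ) (hx : ∀ i, 0 ≤ x i)
    (hy : ∀ i, 0 ≤ y i) :
    ∑ i, x i ^ 2 + ∑ i, y i ^ 2 ≤ (∑ i, x i + ∑ i, y i) ^ 2 := by
  have h1 := Finset.sum_sq_le_sq_sum_of_nonneg (s := Finset.univ) (f := x) fun i _ => hx i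
  have h2 := Finset.sum_sq_le_sq_sum_of_nonneg (s := Finset.univ) (f := y) fun i _ => hy i
  have h3 : 0 ≤ ∑ i, x i := Finset.sum_nonneg fun i _ => hx i
  have h4 : 0 ≤ ∑ i, y i := Finset.sum_nonneg fun i _ => hy i
  nlinarith [mul_nonneg h3 h4]

/-- The argument yields `k⁴`, slightly better than the exponent `9/2` of the claim. -/
lemma pow_four_le_rpow {k : ℕ} (hk : 1 ≤ k) : (k : ℝ) ^ 4 ≤ (k : ℝ) ^ (9 / 2 : ℝ) := by
  rw [← Real.rpow_natCast]
  exact Real.rpow_le_rpow_of_exponent_le (by exact_mod_cast hk) (by norm_num)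

end AsymptoticSubordination

end

open AsymptoticSubordination
theorem theorem5p1 {Ω : Type*} [MeasurableSpace Ω] (P : Measure Ω) [IsProbabilityMeasure P]
    (N k p q : ℕ) (hN : 1 ≤ N) (hk : 1 ≤ k)
    (X : Fin p → Ω → Matrix (Fin N) (Fin N) ℂ) (Y : Fin q → Ω → Matrix (Fin N) (Fin N) ℂ)
    (hX : ∀ j, IsGUE P (X j)) (hX_indep : iIndepFun X P)
    (hY_meas : ∀ j, Measurable (Y j)) (hY_herm : ∀ j, ∀ᵐ ω ∂P, (Y j ω).IsHermitian)
    (hXY_indep : IndepFun (fun ω j => X j ω) (fun ω j => Y j ω) P)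
    (a : Fin p → Matrix (Fin k) (Fin k) ℂ) (b : Fin q → Matrix (Fin k) (Fin k) ℂ)
    (ha : ∀ j, (a j).IsHermitian) (hb : ∀ j, (b j).IsHermitian)
    (S T : Ω → Matrix (Fin k × Fin N) (Fin k × Fin N) ℂ)
    (hS : S = fun ω => blockSum a fun j => X j ω) (hT : T = fun ω => blockSum b fun j => Y j ω)
    (σ : ℝ) (hσ : 1 ≤ σ)
    (hPoincare : PoincareInequality (P.map fun ω => realEntries fun j => Y j ω) (σ / N)) :
    (∀ Λ ∈ upperHalf k, StieltjesDefined P (S + T) Λ ∧ StieltjesDefined P T Λ) ∧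
    ∃ Θ : Matrix (Fin k) (Fin k) ℂ → Matrix (Fin k) (Fin k) ℂ,
      AnalyticOnNhd ℂ Θ (upperHalf k) ∧
      ∀ Λ ∈ upperHalf k,
        Λ - covMap a (stieltjes P (S + T) Λ) ∈ upperHalf k ∧
        stieltjes P (S + T) Λ
          = stieltjes P T (Λ - covMap a (stieltjes P (S + T) Λ)) + Θ Λ ∧
        ‖Θ Λ‖ ≤ 2 * (k : ℝ) ^ (9 / 2 : ℝ) * σ * (∑ j, ‖a j‖ ^ 2)
            * (∑ j, ‖a j‖ + ∑ j, ‖b j‖) ^ 2 / (N : ℝ) ^ 2 * ‖(imPart Λ)⁻¹‖ ^ 5 := by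
  set ν := P.map fun ω => realEntries fun j => Y j ω with hν
  set μ := (gaussianPi (Fin p × (Fin N × Fin N)) (N : NNReal)⁻¹).prod ν with hμ
  have hXm : Measurable fun ω j => X j ω := measurable_pi_iff.mpr fun j => (hX j).measurable
  have hYm : Measurable fun ω j => Y j ω := measurable_pi_iff.mpr hY_meas
  have hxm := measurable_familyCoords.comp hXm
  have hym := measurable_realEntries.comp hYm
  have : IsProbabilityMeasure ν := Measure.isProbabilityMeasure_map hym.aemeasurable
  let φ : Ω → (Fin p × (Fin N × Fin N) → ℝ) ×
      ((Fin q × Fin N × Fin N) ⊕ (Fin q × Fin N × Fin N) → ℝ) :=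
    fun ω => (familyCoords fun j => X j ω, realEntries fun j => Y j ω)
  have hφ : Measurable φ := hxm.prodMk hym
  have hlaw : P.map φ = μ := by
    have h1 := (indepFun_iff_map_prod_eq_prod_map_map hxm.aemeasurable hym.aemeasurable).mp
      (hXY_indep.comp measurable_familyCoords measurable_realEntries)
    have h2 := map_familyCoords_eq_gaussianPi hX hX_indep
    rw [hμ, ← h2, hν]
    exact h1
  set D := blockFrame a (coordFrame N)
  set F := entryBlockFrame b N
  have hD : IsGradientBounded D (∑ j, ‖a j‖ ^ 2) :=
    isGradientBounded_blockFrame isHermitianFrame_coordFrame hN ha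
  have hF : IsGradientBounded F (∑ j, ‖b j‖ ^ 2) := isGradientBounded_entryBlockFrame hN hb
  have hXh : ∀ᵐ ω ∂P, ∀ j, (X j ω).IsHermitian := ae_all_iff.mpr fun j => (hX j).isHermitian
  have hYh : ∀ᵐ ω ∂P, ∀ j, (Y j ω).IsHermitian := ae_all_iff.mpr hY_herm
  have hTe : ∀ᵐ ω ∂P, T ω = sndFamily (Fin p × (Fin N × Fin N)) F (φ ω) := by
    filter_upwards [hYh] with ω hω
    rw [hT]
    exact blockSum_eq_linearFamily_entryBlockFrame b hω
  have hSTe : ∀ᵐ ω ∂P, (S + T) ω = sumFamily D F (φ ω) := by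
    filter_upwards [hXh, hTe] with ω hω hω'
    rw [Pi.add_apply, hω', hS]
    simp only [blockSum_eq_linearFamily a hω]
    rfl
  have hW := sumFamily_isHermitian hD hF
  have hW' := sndFamily_isHermitian (ι := Fin p × (Fin N × Fin N)) hF
  have hpos : ∀ Λ ∈ upperHalf k, 0 < ‖(imPart Λ)⁻¹‖⁻¹ := fun Λ hΛ =>
    inv_pos.mpr (norm_inv_imPart_pos hk hΛ)
  have hST := fun Λ (hΛ : Λ ∈ upperHalf k) =>
    stieltjes_eq_integral_map (P := P) hφ hW hSTe (hpos Λ hΛ) (imGE_of_mem_upperHalf hΛ)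
  have hTT := fun Λ (hΛ : Λ ∈ upperHalf k) =>
    stieltjes_eq_integral_map (P := P) hφ hW' hTe (hpos Λ hΛ) (imGE_of_mem_upperHalf hΛ)
  rw [hlaw] at hST hTT
  have hG : ∀ Λ ∈ upperHalf k, stieltjes P (S + T) Λ = meanResolvent D F Λ ν :=
    fun Λ hΛ => (hST Λ hΛ).2
  -- The same constant serves for `Λ` and for `Γ`: the imaginary part can only grow when `𝓡ₛ(G)` is
  -- subtracted.
  have hΓ : ∀ Λ ∈ upperHalf k,
      ImGE ‖(imPart Λ)⁻¹‖⁻¹ (Λ - covMap a (meanResolvent D F Λ ν)) := fun Λ hΛ =>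
    (imGE_of_mem_upperHalf hΛ).mono_sub (im_quadForm_covMap_nonpos ha
      (im_quadForm_integral_resolvent_nonpos (hpos Λ hΛ) (imGE_of_mem_upperHalf hΛ) hW))
  have hΓm : ∀ Λ ∈ upperHalf k, Λ - covMap a (meanResolvent D F Λ ν) ∈ upperHalf k :=
    fun Λ hΛ => (hΓ Λ hΛ).mem_upperHalf (hpos Λ hΛ)
  -- The map `Θ` is defined as the difference itself, so the subordination identity is immediate;
  -- the content lies in its analyticity and its bound.
  refine ⟨fun Λ hΛ => ⟨(hST Λ hΛ).1, (hTT Λ hΛ).1⟩, fun Λ => meanResolvent D F Λ ν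
    - ∫ z, partialTrace (resolvent (Λ - covMap a (meanResolvent D F Λ ν))
      (sndFamily (Fin p × (Fin N × Fin N)) F) z) ∂μ, fun Λ hΛ => ?_, fun Λ hΛ => ?_⟩
  · have h1 : AnalyticAt ℂ (fun Λ => meanResolvent D F Λ ν) Λ :=
      analyticAt_integral_partialTrace_resolvent (hpos Λ hΛ) (imGE_of_mem_upperHalf hΛ) hW
    have h2 : AnalyticAt ℂ (fun Λ => Λ - covMap a (meanResolvent D F Λ ν)) Λ :=
      analyticAt_id.sub (((covCLM a).analyticAt _).comp h1)
    have h3 := analyticAt_integral_partialTrace_resolvent (μ := μ) (hpos Λ hΛ) (hΓ Λ hΛ) hW'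
    exact h1.sub (AnalyticAt.comp (f := fun Λ => Λ - covMap a (meanResolvent D F Λ ν)) h3 h2)
  · rw [hG Λ hΛ, (hTT _ (hΓm Λ hΛ)).2]
    refine ⟨hΓm Λ hΛ, (add_sub_cancel _ _).symm, ?_⟩
    refine (norm_meanResolvent_sub_le hN hD hF (by positivity) (by positivity)
      (fun B => sum_blockFrame_mul_mul isHermitianFrame_coordFrame hN B) (hpos Λ hΛ)
      (imGE_of_mem_upperHalf hΛ) (hΓ Λ hΛ) rfl hσ hPoincare).trans ?_
    -- With `c = ‖(Im Λ)⁻¹‖⁻¹`, the power `c⁻⁵` is the fifth power of the norm. It remains to weaken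
    -- `k⁴` to `k^{9/2}` and the sum of squared norms to the square of the sum.
    rw [inv_inv]
    gcongr
    · exact pow_four_le_rpow hk
    · exact sum_sq_add_sum_sq_le _ _ (fun _ => norm_nonneg _) fun _ => norm_nonneg _
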